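/- Let $\eta^1=(1,0)$, $\eta^2=(1/2,\sqrt3/2)$, $\eta^3=\eta^1-\eta^2$, $S=\{\pm\eta^1,\pm\eta^2,\pm\eta^3\}$, let $D=\{\eta^\perp:\eta\in S\}$ be the set of coordinate normals, and for $\varepsilon>0$ let $L_\varepsilon=\varepsilon(\mathbb Z\eta^1+\mathbb Z\eta^2)$. Let $J:[0,\infty)\to[0,\infty]$ be continuous and finite on $(0,\infty)$, with $\min J=J(1)=0$, $\lim_{z\to+\infty}J(z)=J_\infty\in(0,\infty)$, $\lim_{z\to0^+}J(z)=+\infty$ and, for every $\delta>0$, $J(z)\ge c_\delta(z-1)^2$ for $0\le z\le\delta$ with some $c_\delta>0$. Let $\Omega\subset\mathbb R^2$ be open and bounded. A function $v\in L^1(\Omega;\mathbb R^2)$ is an interpolation of a discrete function $w:L_\varepsilon\cap\Omega\to\mathbb R^2$ if, on each closed triangle $T\subset\Omega$ with vertices in $L_\varepsilon$ and sides of length $\varepsilon$, it coincides a.e. with the affine function having the values of $w$ at the vertices of $T$; $w$ is admissible if all these affine functions have gradient with positive determinant. Define $$E_\varepsilon(v)=\inf_w\ \sum_{(i,j)}\varepsilon\,J\Big(\Big|\frac{w(i)-w(j)}{\varepsilon}\Big|\Big),$$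 where the infimum is over the admissible $w$ of which $v$ is an interpolation ($+\infty$ if there are none), and the sum is over the unordered pairs $\{i,j\}\subset L_\varepsilon$ with $|i-j|=\varepsilon$ and $[i,j]\subset\Omega$. We write $u_\varepsilon\to u$ if $\sup_\varepsilon\|u_\varepsilon\|_{L^\infty(\Omega)}<\infty$ and $\|u_\varepsilon-u\|_{L^1(\Omega)}\to0$ as $\varepsilon\to0^+$, and $$\Gamma\text{-}\limsup_{\varepsilon\to0^+}E_\varepsilon(u)=\inf\Big\{\limsup_{\varepsilon\to0^+}E_\varepsilon(u_\varepsilon):u_\varepsilon\to u\Big\}.$$ Let $\psi$ be the norm whose unit ball is the convex hull of $S$, $\psi^*(\nu)=\sup_{|\xi|=1}\langle\nu,\xi\rangle/\psi(\xi)$ and $\varphi=\frac{4}{\sqrt3}J_\infty\psi^*$. **Proposition.** Let $R^\pm\in SO(2)$, $\bar x,q^\pm\in\mathbb R^2$, $\nu\in\mathbb R^2$ with $|\nu|=1$, and let $$u(x)=\begin{cases}R^+x+q^+&\text{if }\langle x-\bar x,\nu\rangle>0,\ x\in\Omega,\\ R^-x+q^-&\text{if }\langle x-\bar x,\nu\rangle\le0,\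 x\in\Omega.\end{cases}$$ Let $S_u$ be the set of points of $\Omega$ at which $u$ has no approximate limit, and suppose that $\mathcal H^1(\overline{S_u}\cap\partial\Omega)=0$ (which holds, for instance, whenever $S_u$ is a finite union of segments). Let $\nu_1,\nu_2\in D$, $\lambda\in(0,1)$ and $c>0$ be such that $$c\,\nu=\lambda\nu_1+(1-\lambda)\nu_2 ,$$ that is, $\nu$ is a positive multiple of a convex combination of $\nu_1$ and $\nu_2$. Let $u^+$ and $u^-$ be the traces of $u$ on $S_u$ from the side towards which $\nu$, respectively $-\nu$, points. Assume that for some $\delta>0$ and for $\mathcal H^1$-almost every $x\in S_u$ $$\langle u^+(x)-u^-(x),R^+\nu_i\rangle\ge\delta\quad\text{and}\quad\langle u^+(x)-u^-(x),R^-\nu_i\rangle\ge\delta\qquad\text{for }i=1,2.$$ Then $$\Gamma\text{-}\limsup_{\varepsilon\to0^+}E_\varepsilon(u)\le\int_{S_u}\varphi(\nu)\,d\mathcal H^1 .$$ -/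

import Mathlib

open MeasureTheory Filter Topology
open scoped ENNReal NNReal

noncomputable section

namespace LatticeFracture

/-- The Euclidean plane `ℝ²`. -/
abbrev Plane : Type := EuclideanSpace ℝ (Fin 2)

/-! ### The triangular lattice -/

def eta1 : Plane := !₂[1, 0]

def eta2 : Plane := !₂[1 / 2, Real.sqrt 3 / 2]

def eta3 : Plane := eta1 - eta2

/-- The unit vectors of the triangular lattice. -/
def unitVectors : Set Plane := {eta1, -eta1, eta2, -eta2, eta3, -eta3}

/-- Rotation by a right angle. -/
def perp (x : Plane) : Plane := !₂[-x 1, x 0]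

/-- The set `D` of coordinate directions (coordinate normals). -/
def coordDirections : Set Plane := perp '' unitVectors

/-- The scaled lattice `L_ε = ε (ℤ η¹ + ℤ η²)`. -/
def lattice (ε : ℝ) : Set Plane :=
  {x | ∃ m n : ℤ, x = ε • ((m : ℝ) • eta1 + (n : ℝ) • eta2)}

/-- Strict lexicographic order of the plane. -/
def LexLT (x y : Plane) : Prop := x 0 < y 0 ∨ (x 0 = y 0 ∧ x 1 < y 1)

/-- Nearest-neighbour pairs whose segment lies in `Ω`, each pair being listed once. -/
def bonds (Ω : Set Plane) (ε : ℝ) : Set (Plane × Plane) :=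
  {p | p.1 ∈ lattice ε ∧ p.2 ∈ lattice ε ∧ segment ℝ p.1 p.2 ⊆ Ω ∧
    dist p.1 p.2 = ε ∧ LexLT p.1 p.2}

/-- `a, b, c` are the vertices of a lattice triangle of side `ε` whose closed convex hull
lies in `Ω`. -/
def IsTriangleIn (Ω : Set Plane) (ε : ℝ) (a b c : Plane) : Prop :=
  a ∈ lattice ε ∧ b ∈ lattice ε ∧ c ∈ lattice ε ∧
    dist a b = ε ∧ dist b c = ε ∧ dist c a = ε ∧ convexHull ℝ {a, b, c} ⊆ Ω

/-! ### Discrete functions, interpolations and energies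

A discrete function on `L_ε ∩ Ω` is given by a map `w : Plane → Plane` of which only the values
at the points of `L_ε ∩ Ω` are ever used. -/

/-- `v` is an interpolation of `w`: on each lattice triangle contained in `Ω` it coincides
(almost everywhere) with the affine function having the values of `w` at the vertices.
It is arbitrary elsewhere. -/
def IsInterpolation (Ω : Set Plane) (ε : ℝ) (w v : Plane → Plane) : Prop :=
  ∀ a b c : Plane, IsTriangleIn Ω ε a b c →
    ∃ A : Plane →ᵃ[ℝ] Plane, A a = w a ∧ A b = w b ∧ A c = w c ∧
      ∀ᵐ x ∂(volume.restrict (convexHull ℝ {a, b, c})), v x = A x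

/-- The positive-determinant constraint: on each lattice triangle contained in `Ω` the affine
interpolation of `w` has gradient with positive determinant. -/
def Admissible (Ω : Set Plane) (ε : ℝ) (w : Plane → Plane) : Prop :=
  ∀ a b c : Plane, IsTriangleIn Ω ε a b c →
    ∃ A : Plane →ᵃ[ℝ] Plane, A a = w a ∧ A b = w b ∧ A c = w c ∧
      0 < LinearMap.det A.linear

/-- Structure properties of the interatomic potential `J : [0, ∞) → [0, ∞]`, with the minimum
point normalized to `1` and with limit `Jinf` at infinity. It is finite except at `0`. -/
structure IsPotential (J : ℝ≥0 → ℝ≥0∞) (Jinf : ℝ) : Prop where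
  continuous : Continuous J
  finite : ∀ z : ℝ≥0, z ≠ 0 → J z ≠ ∞
  min_eq : J 1 = 0
  limit_pos : 0 < Jinf
  tendsto_atTop : Tendsto J atTop (𝓝 (ENNReal.ofReal Jinf))
  tendsto_zero : Tendsto J (𝓝[>] 0) (𝓝 ∞)
  quadratic : ∀ δ : ℝ, 0 < δ → ∃ c : ℝ, 0 < c ∧
    ∀ z : ℝ≥0, (z : ℝ) ≤ δ → ENNReal.ofReal (c * ((z : ℝ) - 1) ^ 2) ≤ J z

/-- `∑ ε J(|w(i) - w(j)| / ε)` over the nearest-neighbour pairs in `Ω`. -/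
def pairEnergy (J : ℝ≥0 → ℝ≥0∞) (Ω : Set Plane) (ε : ℝ) (w : Plane → Plane) : ℝ≥0∞ :=
  ∑' p : bonds Ω ε, ENNReal.ofReal ε * J ‖ε⁻¹ • (w p.1.1 - w p.1.2)‖₊

/-- The energy `E_ε` of a function on `Ω`: the pair energy of the admissible discrete function
which it interpolates, and `+∞` if it is not an interpolation of such a function. (The infimum
accounts for the lattice points close to `∂Ω` that belong to no triangle contained in `Ω`, where
an interpolation does not determine the discrete function.) -/
def energy (J : ℝ≥0 → ℝ≥0∞) (Ω : Set Plane) (ε : ℝ) (v : Plane → Plane) : ℝ≥0∞ :=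
  ⨅ (w : Plane → Plane) (_ : Admissible Ω ε w ∧ IsInterpolation Ω ε w v), pairEnergy J Ω ε w

/-- Convergence `v_ε → u` as `ε → 0⁺`: equibounded in `L^∞(Ω)` and convergent in `L¹(Ω)`. -/
def ConvergesTo (Ω : Set Plane) (v : ℝ → Plane → Plane) (u : Plane → Plane) : Prop :=
  (∀ ε : ℝ, 0 < ε → IntegrableOn (v ε) Ω) ∧
  (∃ M : ℝ≥0, ∀ ε : ℝ, 0 < ε → eLpNorm (v ε) ∞ (volume.restrict Ω) ≤ M) ∧
  Tendsto (fun ε : ℝ => eLpNorm (fun x => v ε x - u x) 1 (volume.restrict Ω))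
    (𝓝[>] 0) (𝓝 0)

/-- The `Γ`-limsup as `ε → 0⁺` with respect to the above convergence. -/
def gammaLimsup (Ω : Set Plane) (F : ℝ → (Plane → Plane) → ℝ≥0∞) (u : Plane → Plane) : ℝ≥0∞ :=
  ⨅ (v : ℝ → Plane → Plane) (_ : ConvergesTo Ω v u), limsup (fun ε : ℝ => F ε (v ε)) (𝓝[>] 0)

/-! ### The surface energy density -/

/-- The norm whose unit ball is the convex hull of the unit vectors of the lattice. -/
def psi (ξ : Plane) : ℝ := gauge (convexHull ℝ unitVectors) ξ

/-- The dual norm of `psi`. -/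
def psiStar (ν : Plane) : ℝ :=
  ⨆ ξ : Metric.sphere (0 : Plane) 1, inner ℝ ν (ξ : Plane) / psi (ξ : Plane)

/-- The surface energy density `φ = (4 / √3) J_∞ ψ*`. -/
def phi (Jinf : ℝ) (ν : Plane) : ℝ := Jinf * (4 / Real.sqrt 3) * psiStar ν

/-! ### Discontinuity set and traces -/

/-- The set `S_u` of the points of `Ω` at which `u` has no approximate limit. -/
def jumpSet (Ω : Set Plane) (u : Plane → Plane) : Set Plane :=
  {x | x ∈ Ω ∧ ¬ ∃ z : Plane,
    Tendsto (fun r : ℝ => ⨍ y in Metric.ball x r, ‖u y - z‖) (𝓝[>] 0) (𝓝 0)}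

/-- `a` is the trace of `u` at `x` from the side towards which `n` points. -/
def IsTrace (u : Plane → Plane) (x n a : Plane) : Prop :=
  Tendsto (fun r : ℝ => ⨍ y in Metric.ball x r ∩ {y | 0 < inner ℝ (y - x) n}, ‖u y - a‖)
    (𝓝[>] 0) (𝓝 0)

/-! ### Two-piece rigid deformations -/

/-- The matrix `R` acting on a vector of the plane. -/
def act (R : Matrix (Fin 2) (Fin 2) ℝ) (x : Plane) : Plane := Matrix.toEuclideanLin R x

open Classical in
/-- The map equal to `Rp x + qp` where `⟨x - x₀, ν⟩ > 0` and to `Rm x + qm` where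
`⟨x - x₀, ν⟩ ≤ 0`. -/
def twoPiece (Rp Rm : Matrix (Fin 2) (Fin 2) ℝ) (x₀ ν qp qm : Plane) (x : Plane) : Plane :=
  if 0 < inner ℝ (x - x₀) ν then act Rp x + qp else act Rm x + qm

end LatticeFracture

end

open LatticeFracture

noncomputable section

namespace LatticeFracture

/-! ### Coordinates in the plane -/

/-! The recovery sequence is the deformation itself, sampled on the lattice and interpolated on the
triangles; nothing is modified near the interface. It converges by dominated convergence, since away
from the null line the interpolation eventually equals the rigid motion (`convergesTo_recovery`).

Energy. A bond that does not cross the interface is moved rigidly, keeps its length `ε` and costs `J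
1 = 0`. A crossing bond is stretched to length at least `δ - 2ε`, so its cost is at most `εM` for
any `M > Jinf` and `ε` small. Bonds of direction `e` meet the interface at points at least `ε√3 /
(2|⟨e, ν⟩|)` apart, which gives the density `(2/√3)|⟨e, ν⟩|` (`tsum_crossing_le`). Since `η³ = η¹ -
η²`, the three numbers `|⟨e, ν⟩|` add up to twice the largest, hence to at most `2ψ*(ν)`
(`sum_abs_inner_le`); this is the density `φ`.

Determinant constraint. A triangle cut by the interface has one vertex `a` on one side and an edge
`bc` on the other, moved by a single rotation `R`. The orientation survives iff `w a - w b` has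
positive product with `R n`, where `n` is the normal of `bc` pointing to `a`. As `ν` lies in the
cone of `ν₁` and `ν₂`, integrality of lattice heights forces `n` to be `ν₁`, `ν₂` or `ν₁ + ν₂`, so
the opening condition suffices (`one_one_of_combination`, `oriented_of_separated`).

From almost every point to every point. The jump is affine along the interface and the opening
condition is closed, so in `Ω` the jump either vanishes throughout or satisfies the condition
everywhere (`jump_dichotomy`). In the first case each triangle and bond sees one rigid motion and
the energy is zero. In the second the count yields the length of the closure of the interface, and
the hypothesis on `∂Ω` makes the added endpoints negligible (`volume_closure_line_preimage_le`). -/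

lemma plane_ext {x y : Plane} (h0 : x 0 = y 0) (h1 : x 1 = y 1) : x = y := by
  ext i; fin_cases i <;> assumption

lemma inner_eq (x y : Plane) : inner ℝ x y = x 0 * y 0 + x 1 * y 1 := by
  simp [PiLp.inner_apply, Fin.sum_univ_two, mul_comm]

lemma norm_sq_eq (x : Plane) : ‖x‖ ^ 2 = x 0 ^ 2 + x 1 ^ 2 := by
  rw [← real_inner_self_eq_norm_sq, inner_eq]; ring

/-- The oriented area of the parallelogram spanned by two vectors. -/
def cross (x y : Plane) : ℝ := x 0 * y 1 - x 1 * y 0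

@[simp] lemma perp_zero (x : Plane) : perp x 0 = -x 1 := by simp [perp]
@[simp] lemma perp_one (x : Plane) : perp x 1 = x 0 := by simp [perp]

lemma norm_perp (x : Plane) : ‖perp x‖ = ‖x‖ := by
  have h : ‖perp x‖ ^ 2 = ‖x‖ ^ 2 := by rw [norm_sq_eq, norm_sq_eq]; simp; ring
  exact (pow_left_inj₀ (norm_nonneg _) (norm_nonneg _) two_ne_zero).1 h

/-! ### Rotations -/

/-- `R` is a rotation of the plane. -/
def IsRot (R : Matrix (Fin 2) (Fin 2) ℝ) : Prop :=
  R 1 1 = R 0 0 ∧ R 0 1 = -R 1 0 ∧ R 0 0 ^ 2 + R 1 0 ^ 2 = 1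

lemma isRot_of_mem {R : Matrix (Fin 2) (Fin 2) ℝ}
    (h : R ∈ Matrix.specialOrthogonalGroup (Fin 2) ℝ) : IsRot R := by
  rw [Matrix.mem_specialOrthogonalGroup_iff, Matrix.mem_orthogonalGroup_iff'] at h
  obtain ⟨h1, h2⟩ := h
  rw [Matrix.det_fin_two] at h2
  have e00 := congrFun (congrFun h1 0) 0
  have e01 := congrFun (congrFun h1 0) 1
  have e11 := congrFun (congrFun h1 1) 1
  simp [Matrix.mul_apply, Fin.sum_univ_two] at e00 e01 e11
  have h3 : R 1 1 = R 0 0 := by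
    linear_combination R 0 0 * h2 - R 1 1 * e00 + R 1 0 * e01
  refine ⟨h3, ?_, by linear_combination e00⟩
  linear_combination (-R 1 0) * h2 - R 0 1 * e00 + R 0 0 * e01

lemma act_zero_coord (R : Matrix (Fin 2) (Fin 2) ℝ) (x : Plane) :
    act R x 0 = R 0 0 * x 0 + R 0 1 * x 1 := by
  simp [act, Matrix.toLpLin_apply]

lemma act_one_coord (R : Matrix (Fin 2) (Fin 2) ℝ) (x : Plane) :
    act R x 1 = R 1 0 * x 0 + R 1 1 * x 1 := by
  simp [act, Matrix.toLpLin_apply]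

lemma act_add (R : Matrix (Fin 2) (Fin 2) ℝ) (x y : Plane) : act R (x + y) = act R x + act R y :=
  map_add _ _ _

lemma act_sub (R : Matrix (Fin 2) (Fin 2) ℝ) (x y : Plane) : act R (x - y) = act R x - act R y :=
  map_sub _ _ _

lemma act_smul (R : Matrix (Fin 2) (Fin 2) ℝ) (r : ℝ) (x : Plane) : act R (r • x) = r • act R x :=
  map_smul _ _ _

lemma IsRot.norm_act {R : Matrix (Fin 2) (Fin 2) ℝ} (hR : IsRot R) (x : Plane) :
    ‖act R x‖ = ‖x‖ := by
  obtain ⟨h1, h2, h3⟩ := hR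
  have h : ‖act R x‖ ^ 2 = ‖x‖ ^ 2 := by
    rw [norm_sq_eq, norm_sq_eq, act_zero_coord, act_one_coord, h1, h2]
    linear_combination (x 0 ^ 2 + x 1 ^ 2) * h3
  exact (pow_left_inj₀ (norm_nonneg _) (norm_nonneg _) two_ne_zero).1 h

lemma IsRot.cross_act {R : Matrix (Fin 2) (Fin 2) ℝ} (hR : IsRot R) (x y : Plane) :
    cross (act R x) (act R y) = cross x y := by
  obtain ⟨h1, h2, h3⟩ := hR
  simp only [cross, act_zero_coord, act_one_coord, h1, h2]
  linear_combination (x 0 * y 1 - x 1 * y 0) * h3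

lemma continuous_act (R : Matrix (Fin 2) (Fin 2) ℝ) : Continuous (act R) :=
  (Matrix.toEuclideanLin R).continuous_of_finiteDimensional

/-- The affine map `x ↦ R x + q`. -/
def rigid (R : Matrix (Fin 2) (Fin 2) ℝ) (q : Plane) : Plane →ᵃ[ℝ] Plane :=
  (Matrix.toEuclideanLin R).toAffineMap + AffineMap.const ℝ Plane q

lemma rigid_apply (R : Matrix (Fin 2) (Fin 2) ℝ) (q x : Plane) : rigid R q x = act R x + q := rfl

/-- Two rotations which agree on a nonzero vector are equal. -/
lemma IsRot.eq_of_act_eq {R R' : Matrix (Fin 2) (Fin 2) ℝ} (hR : IsRot R) (hR' : IsRot R')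
    {x : Plane} (hx : x ≠ 0) (h : act R x = act R' x) : R = R' := by
  obtain ⟨h1, h2, -⟩ := hR
  obtain ⟨h1', h2', -⟩ := hR'
  have e0 := congrArg (fun z : Plane => z 0) h
  have e1 := congrArg (fun z : Plane => z 1) h
  simp only [act_zero_coord, act_one_coord, h1, h2, h1', h2'] at e0 e1
  have hn : x 0 ^ 2 + x 1 ^ 2 ≠ 0 := by rw [← norm_sq_eq]; simpa using hx
  have ha : R 0 0 = R' 0 0 := by
    apply mul_right_cancel₀ hn; linear_combination x 0 * e0 + x 1 * e1
  have hb : R 1 0 = R' 1 0 := by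
    apply mul_right_cancel₀ hn; linear_combination x 0 * e1 - x 1 * e0
  ext i j
  fin_cases i <;> fin_cases j <;> simp [h1, h2, h1', h2', ha, hb]

/-! ### Affine maps with prescribed values on a triangle -/

lemma exists_affineMap_of_cross_ne_zero {a b c : Plane} (h : cross (b - a) (c - a) ≠ 0)
    (x y z : Plane) :
    ∃ A : Plane →ᵃ[ℝ] Plane, A a = x ∧ A b = y ∧ A c = z ∧
      LinearMap.det A.linear * cross (b - a) (c - a) = cross (y - x) (z - x) := by
  set D := cross (b - a) (c - a) with hD
  -- Cramer's rule: the matrix with columns `y - x`, `z - x` times the inverse of the one with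
  -- columns `b - a`, `c - a`.
  let M : Matrix (Fin 2) (Fin 2) ℝ :=
    Matrix.of fun i j => if j = 0 then ((c - a) 1 * (y - x) i - (b - a) 1 * (z - x) i) / D
      else ((b - a) 0 * (z - x) i - (c - a) 0 * (y - x) i) / D
  have hb : act M (b - a) = y - x := by
    apply plane_ext
    · rw [act_zero_coord]; simp only [M, Matrix.of_apply, if_true, one_ne_zero, if_false]
      field_simp; rw [hD]; simp only [cross]; ring
    · rw [act_one_coord]; simp only [M, Matrix.of_apply, if_true, one_ne_zero, if_false]
      field_simp; rw [hD]; simp only [cross]; ring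
  have hc : act M (c - a) = z - x := by
    apply plane_ext
    · rw [act_zero_coord]; simp only [M, Matrix.of_apply, if_true, one_ne_zero, if_false]
      field_simp; rw [hD]; simp only [cross]; ring
    · rw [act_one_coord]; simp only [M, Matrix.of_apply, if_true, one_ne_zero, if_false]
      field_simp; rw [hD]; simp only [cross]; ring
  have hdet : LinearMap.det (rigid M (x - act M a)).linear = M.det := by
    have : (rigid M (x - act M a)).linear = Matrix.toEuclideanLin M := by
      ext v; simp [rigid]
    rw [this]
    exact LinearMap.det_toLin (PiLp.basisFun 2 ℝ (Fin 2)) M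
  refine ⟨rigid M (x - act M a), ?_, ?_, ?_, ?_⟩
  · rw [rigid_apply]; abel
  · rw [rigid_apply]; rw [act_sub] at hb
    rw [show act M b + (x - act M a) = (act M b - act M a) + x by abel, hb]; abel
  · rw [rigid_apply]; rw [act_sub] at hc
    rw [show act M c + (x - act M a) = (act M c - act M a) + x by abel, hc]; abel
  · rw [hdet, Matrix.det_fin_two]
    rw [← hb, ← hc, hD]
    simp only [cross, act_zero_coord, act_one_coord]; ring

/-- The affine interpolation of `w` on the triangle with vertices `a, b, c` preserves
orientation (and the triangle is not degenerate). -/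
def Oriented (w : Plane → Plane) (a b c : Plane) : Prop :=
  0 < cross (b - a) (c - a) * cross (w b - w a) (w c - w a)

lemma Oriented.exists_affineMap {w : Plane → Plane} {a b c : Plane} (h : Oriented w a b c) :
    ∃ A : Plane →ᵃ[ℝ] Plane, A a = w a ∧ A b = w b ∧ A c = w c ∧ 0 < LinearMap.det A.linear := by
  have h0 : cross (b - a) (c - a) ≠ 0 := by
    intro h0; unfold Oriented at h; rw [h0, zero_mul] at h; exact lt_irrefl _ h
  obtain ⟨A, h1, h2, h3, h4⟩ := exists_affineMap_of_cross_ne_zero h0 (w a) (w b) (w c)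
  refine ⟨A, h1, h2, h3, ?_⟩
  unfold Oriented at h
  rw [← h4, mul_comm, mul_assoc] at h
  exact (pos_iff_pos_of_mul_pos h).2 (mul_self_pos.2 h0)

lemma cross_cyclic (a b c : Plane) : cross (c - b) (a - b) = cross (b - a) (c - a) := by
  simp only [cross, PiLp.sub_apply]; ring

lemma Oriented.rotate {w : Plane → Plane} {a b c : Plane} (h : Oriented w b c a) :
    Oriented w a b c := by
  unfold Oriented at *; rwa [← cross_cyclic a b c, ← cross_cyclic (w a) (w b) (w c)]

lemma oriented_of_rigid {w : Plane → Plane} {a b c : Plane} {R : Matrix (Fin 2) (Fin 2) ℝ}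
    {q : Plane} (hR : IsRot R) (h : cross (b - a) (c - a) ≠ 0)
    (ha : w a = act R a + q) (hb : w b = act R b + q) (hc : w c = act R c + q) :
    Oriented w a b c := by
  unfold Oriented
  rw [ha, hb, hc, add_sub_add_right_eq_sub, add_sub_add_right_eq_sub, ← act_sub, ← act_sub,
    hR.cross_act]
  exact mul_self_pos.2 h

/-! ### Lattice vectors -/

/-- The point with coordinates `s, t` in the basis `η¹, η²`. -/
def pt (s t : ℝ) : Plane := s • eta1 + t • eta2

@[simp] lemma pt_zero (s t : ℝ) : pt s t 0 = s + t / 2 := by simp [pt, eta1, eta2]; ring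
@[simp] lemma pt_one (s t : ℝ) : pt s t 1 = t * (Real.sqrt 3 / 2) := by simp [pt, eta1, eta2]

lemma sqrt_three_sq : Real.sqrt 3 * Real.sqrt 3 = 3 := Real.mul_self_sqrt (by norm_num)
lemma sqrt_three_pos : 0 < Real.sqrt 3 := Real.sqrt_pos.2 (by norm_num)

lemma cross_pt (s t s' t' : ℝ) : cross (pt s t) (pt s' t') = Real.sqrt 3 / 2 * (s * t' - t * s') := by
  simp only [cross, pt_zero, pt_one]; ring

lemma norm_sq_pt (s t : ℝ) : ‖pt s t‖ ^ 2 = s ^ 2 + s * t + t ^ 2 := by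
  rw [norm_sq_eq, pt_zero, pt_one]; linear_combination t ^ 2 / 4 * sqrt_three_sq

lemma pt_sub (s t s' t' : ℝ) : pt s t - pt s' t' = pt (s - s') (t - t') := by
  apply plane_ext <;> simp <;> ring

lemma smul_pt (r s t : ℝ) : r • pt s t = pt (r * s) (r * t) := by
  apply plane_ext <;> simp <;> ring

lemma mem_lattice_iff {ε : ℝ} {x : Plane} :
    x ∈ lattice ε ↔ ∃ m n : ℤ, x = ε • pt m n := Iff.rfl

/-- The integer vectors of unit length for the form `i² + ij + j²`. -/
def HexUnit (i j : ℤ) : Prop := i * i + i * j + j * j = 1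

lemma HexUnit.cases {i j : ℤ} (h : HexUnit i j) :
    (i = 1 ∧ j = 0) ∨ (i = -1 ∧ j = 0) ∨ (i = 0 ∧ j = 1) ∨ (i = 0 ∧ j = -1) ∨
      (i = 1 ∧ j = -1) ∨ (i = -1 ∧ j = 1) := by
  unfold HexUnit at h
  -- The bounds come from `4(i² + ij + j²) = 3i² + (i + 2j)²` and its analogue with `i` and `j`
  -- exchanged.
  have h1 : i ≤ 1 := by nlinarith [sq_nonneg (i + 2 * j)]
  have h2 : -1 ≤ i := by nlinarith [sq_nonneg (i + 2 * j)]
  have h3 : j ≤ 1 := by nlinarith [sq_nonneg (j + 2 * i)]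
  have h4 : -1 ≤ j := by nlinarith [sq_nonneg (j + 2 * i)]
  interval_cases i <;> interval_cases j <;> simp_all

lemma hexUnit_of_dist {ε : ℝ} (hε : 0 < ε) {m n m' n' : ℤ}
    (h : dist (ε • pt m n) (ε • pt m' n') = ε) : HexUnit (m' - m) (n' - n) := by
  rw [dist_comm, dist_eq_norm, ← smul_sub, norm_smul, Real.norm_eq_abs, abs_of_pos hε, pt_sub] at h
  have h1 : ‖pt ((m' : ℝ) - m) (n' - n)‖ = 1 := by
    have : ε * ‖pt ((m' : ℝ) - m) (n' - n)‖ = ε * 1 := by rw [h, mul_one]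
    exact mul_left_cancel₀ hε.ne' this
  have h2 := norm_sq_pt ((m' : ℝ) - m) (n' - n)
  rw [h1] at h2
  unfold HexUnit
  have : (((m' - m) * (m' - m) + (m' - m) * (n' - n) + (n' - n) * (n' - n) : ℤ) : ℝ) = (1 : ℤ) := by
    push_cast; linarith
  exact_mod_cast this

lemma hexUnit_of_mem_unitVectors {s : Plane} (h : s ∈ unitVectors) :
    ∃ i j : ℤ, HexUnit i j ∧ s = pt i j := by
  simp only [unitVectors, Set.mem_insert_iff, Set.mem_singleton_iff] at h
  rcases h with h | h | h | h | h | h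
  · exact ⟨1, 0, by norm_num [HexUnit], by simp [h, pt]⟩
  · exact ⟨-1, 0, by norm_num [HexUnit], by simp [h, pt]⟩
  · exact ⟨0, 1, by norm_num [HexUnit], by simp [h, pt]⟩
  · exact ⟨0, -1, by norm_num [HexUnit], by simp [h, pt]⟩
  · exact ⟨1, -1, by norm_num [HexUnit], by simp [h, pt, eta3]; abel⟩
  · exact ⟨-1, 1, by norm_num [HexUnit], by simp [h, pt, eta3]; abel⟩

/-- Integer coordinates of a lattice triangle. -/
lemma IsTriangleIn.exists_coords {Ω : Set Plane} {ε : ℝ} (hε : 0 < ε) {a b c : Plane}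
    (h : IsTriangleIn Ω ε a b c) :
    ∃ m n i j k l : ℤ, a = ε • pt m n ∧ b = ε • pt (m + i : ℤ) (n + j : ℤ) ∧
      c = ε • pt (m + k : ℤ) (n + l : ℤ) ∧ HexUnit i j ∧ HexUnit k l ∧ HexUnit (k - i) (l - j) := by
  obtain ⟨⟨m, n, ha⟩, ⟨m1, n1, hb⟩, ⟨m2, n2, hc⟩, hab, hbc, hca, -⟩ := h
  change a = ε • pt m n at ha
  change b = ε • pt m1 n1 at hb
  change c = ε • pt m2 n2 at hc
  subst ha hb hc
  refine ⟨m, n, m1 - m, n1 - n, m2 - m, n2 - n, rfl, by simp, by simp,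
    hexUnit_of_dist hε hab, ?_, ?_⟩
  · rw [dist_comm] at hca; exact hexUnit_of_dist hε hca
  · have := hexUnit_of_dist hε hbc
    convert this using 1 <;> ring

lemma HexUnit.det_sq {i j k l : ℤ} (h : HexUnit i j) (h' : HexUnit k l)
    (h'' : HexUnit (k - i) (l - j)) : (i * l - j * k) * (i * l - j * k) = 1 := by
  rcases h.cases with ⟨rfl, rfl⟩ | ⟨rfl, rfl⟩ | ⟨rfl, rfl⟩ | ⟨rfl, rfl⟩ | ⟨rfl, rfl⟩ | ⟨rfl, rfl⟩ <;>
  rcases h'.cases with ⟨rfl, rfl⟩ | ⟨rfl, rfl⟩ | ⟨rfl, rfl⟩ | ⟨rfl, rfl⟩ | ⟨rfl, rfl⟩ | ⟨rfl, rfl⟩ <;>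
  simp_all [HexUnit]

/-- Heights of neighbouring lattice points over a coordinate direction differ by at most one row;
this is the integrality behind `one_one_of_combination`. -/
lemma HexUnit.abs_det_le {i j k l : ℤ} (h : HexUnit i j) (h' : HexUnit k l) :
    -1 ≤ i * l - j * k ∧ i * l - j * k ≤ 1 := by
  rcases h.cases with ⟨rfl, rfl⟩ | ⟨rfl, rfl⟩ | ⟨rfl, rfl⟩ | ⟨rfl, rfl⟩ | ⟨rfl, rfl⟩ | ⟨rfl, rfl⟩ <;>
  rcases h'.cases with ⟨rfl, rfl⟩ | ⟨rfl, rfl⟩ | ⟨rfl, rfl⟩ | ⟨rfl, rfl⟩ | ⟨rfl, rfl⟩ | ⟨rfl, rfl⟩ <;>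
  simp

lemma coords_sub (ε : ℝ) (m n i j : ℤ) :
    ε • pt (m + i : ℤ) (n + j : ℤ) - ε • pt m n = ε • pt i j := by
  rw [← smul_sub, pt_sub]; push_cast; simp

lemma cross_smul_pt (ε s t s' t' : ℝ) :
    cross (ε • pt s t) (ε • pt s' t') = ε ^ 2 * (Real.sqrt 3 / 2) * (s * t' - t * s') := by
  rw [smul_pt, smul_pt, cross_pt]; ring

lemma IsTriangleIn.cross_ne_zero {Ω : Set Plane} {ε : ℝ} (hε : 0 < ε) {a b c : Plane}
    (h : IsTriangleIn Ω ε a b c) : cross (b - a) (c - a) ≠ 0 := by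
  obtain ⟨m, n, i, j, k, l, rfl, rfl, rfl, h1, h2, h3⟩ := h.exists_coords hε
  rw [coords_sub, coords_sub, cross_smul_pt]
  have hd := h1.det_sq h2 h3
  have : i * l - j * k ≠ 0 := by rintro h0; rw [h0] at hd; simp at hd
  have h' : ((i : ℝ) * l - j * k) ≠ 0 := by exact_mod_cast this
  have := sqrt_three_pos
  positivity

/-- If `(a₁, b₁)`, `(a₂, b₂)` are pairs of numbers in `{-1, 0, 1}` with difference in the same set
and a convex combination of them is positive, then `(1, 1)` is one of them or their sum. -/
lemma one_one_of_combination {a₁ b₁ a₂ b₂ : ℤ} {t : ℝ} (ht : t ∈ Set.Ioo (0 : ℝ) 1)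
    (h1 : -1 ≤ a₁ ∧ a₁ ≤ 1) (h2 : -1 ≤ b₁ ∧ b₁ ≤ 1) (h3 : -1 ≤ a₁ - b₁ ∧ a₁ - b₁ ≤ 1)
    (h4 : -1 ≤ a₂ ∧ a₂ ≤ 1) (h5 : -1 ≤ b₂ ∧ b₂ ≤ 1) (h6 : -1 ≤ a₂ - b₂ ∧ a₂ - b₂ ≤ 1)
    (ha : 0 < t * a₁ + (1 - t) * a₂) (hb : 0 < t * b₁ + (1 - t) * b₂) :
    (a₁ = 1 ∧ b₁ = 1) ∨ (a₂ = 1 ∧ b₂ = 1) ∨ (a₁ + a₂ = 1 ∧ b₁ + b₂ = 1) := by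
  obtain ⟨ht0, ht1⟩ := ht
  have key : ∀ p q : ℤ, 0 < t * p + (1 - t) * q → 0 < p ∨ 0 < q := by
    intro p q h
    by_contra! hc
    have hp : (p : ℝ) ≤ 0 := by exact_mod_cast hc.1
    have hq : (q : ℝ) ≤ 0 := by exact_mod_cast hc.2
    nlinarith
  have ka := key _ _ ha
  have kb := key _ _ hb
  -- If neither pair is `(1, 1)`, one pair has first entry `1` and the other has second entry `1`;
  -- the bounds on the differences then make the remaining entries `0`.
  omega

/-- The orientation of a triangle of which the vertex `a` is separated from the side `bc`. -/
lemma oriented_of_separated {Ω : Set Plane} {ε : ℝ} (hε : 0 < ε) {a b c : Plane}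
    (hT : IsTriangleIn Ω ε a b c) {ν ν₁ ν₂ : Plane} (hν₁ : ν₁ ∈ coordDirections)
    (hν₂ : ν₂ ∈ coordDirections) {t r : ℝ} (ht : t ∈ Set.Ioo (0 : ℝ) 1) (hr : 0 < r)
    (hdecomp : r • ν = t • ν₁ + (1 - t) • ν₂)
    (hb : 0 < inner ℝ (a - b) ν) (hc : 0 < inner ℝ (a - c) ν)
    {R : Matrix (Fin 2) (Fin 2) ℝ} (hR : IsRot R) {w : Plane → Plane}
    (hbc : w b - w c = act R (b - c))
    (h₁ : 0 < inner ℝ (w a - w b) (act R ν₁)) (h₂ : 0 < inner ℝ (w a - w b) (act R ν₂)) :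
    Oriented w a b c := by
  obtain ⟨m, n, i, j, k, l, ha', hb', hc', hij, hkl, hd⟩ := hT.exists_coords hε
  obtain ⟨_, hs₁, rfl⟩ := hν₁
  obtain ⟨_, hs₂, rfl⟩ := hν₂
  obtain ⟨e, f, hef, rfl⟩ := hexUnit_of_mem_unitVectors hs₁
  obtain ⟨g, h, hgh, rfl⟩ := hexUnit_of_mem_unitVectors hs₂
  have hba : b - a = ε • pt i j := by rw [ha', hb', coords_sub]
  have hca : c - a = ε • pt k l := by rw [ha', hc', coords_sub]
  have hcb : c - b = ε • pt (k - i) (l - j) := by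
    rw [show c - b = (c - a) - (b - a) by abel, hca, hba, ← smul_sub, pt_sub]
  have h3 := sqrt_three_pos
  -- The integers `f * p - e * q` and `h * p - g * q` are the heights of `a` over `z` in the
  -- directions `ν₁` and `ν₂`, in units of the row spacing `ε√3/2`; separation by `ν` makes their
  -- convex combination positive.
  have hpos : ∀ (p q : ℤ) (z : Plane), z - a = ε • pt p q → 0 < inner ℝ (a - z) ν →
      0 < t * ((f * p - e * q : ℤ) : ℝ) + (1 - t) * ((h * p - g * q : ℤ) : ℝ) := by
    intro p q z hz hin
    have e1 : inner ℝ (a - z) (r • ν) = ε * (Real.sqrt 3 / 2) *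
        (t * ((f * p - e * q : ℤ) : ℝ) + (1 - t) * ((h * p - g * q : ℤ) : ℝ)) := by
      rw [hdecomp, ← neg_sub, hz, inner_eq]
      simp
      ring
    rw [inner_smul_right] at e1
    have : 0 < ε * (Real.sqrt 3 / 2) := by positivity
    have h5 : 0 < r * inner ℝ (a - z) ν := by positivity
    rw [e1] at h5
    exact (mul_pos_iff_of_pos_left this).1 h5
  have pb := hpos i j b hba hb
  have pc := hpos k l c hca hc
  have b1 := hef.abs_det_le hij
  have b2 := hef.abs_det_le hkl
  have b3 := hef.abs_det_le hd
  have b4 := hgh.abs_det_le hij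
  have b5 := hgh.abs_det_le hkl
  have b6 := hgh.abs_det_le hd
  have hdet := hij.det_sq hkl hd
  set d := i * l - j * k with hdd
  have hdR : (d : ℝ) * d = 1 := by exact_mod_cast hdet
  have comb := one_one_of_combination ht (a₁ := f * i - e * j) (b₁ := f * k - e * l)
    (a₂ := h * i - g * j) (b₂ := h * k - g * l) ⟨by linarith, by linarith⟩ ⟨by linarith, by linarith⟩
    ⟨by linarith, by linarith⟩ ⟨by linarith, by linarith⟩ ⟨by linarith, by linarith⟩
    ⟨by linarith, by linarith⟩ pb pc
  -- If `a` is exactly one row above both `b` and `c` in the direction `perp (pt x y)`, then this is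
  -- the normal of `bc` pointing to `a`. The sign `d = ±1` records the order of the vertices and
  -- cancels because `d * d = 1`.
  have solve : ∀ x y : ℤ, y * i - x * j = 1 → y * k - x * l = 1 →
      0 < inner ℝ (w a - w b) (act R (perp (pt x y))) → Oriented w a b c := by
    intro x y hx hy hin
    have ex : d * x = k - i := by rw [hdd]; linear_combination k * hx - i * hy
    have ey : d * y = l - j := by rw [hdd]; linear_combination l * hx - j * hy
    have ex' : (d : ℝ) * x = k - i := by exact_mod_cast ex
    have ey' : (d : ℝ) * y = l - j := by exact_mod_cast ey
    unfold Oriented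
    have hwc : w c - w a = (w b - w a) - act R (b - c) := by rw [← hbc]; abel
    have hbc' : b - c = (-(ε * d)) • pt x y := by
      rw [← neg_sub, hcb, neg_smul, mul_smul, smul_pt d, ex', ey']
    have e1 : cross (w b - w a) (w c - w a) =
        ε * d * inner ℝ (w a - w b) (act R (perp (pt x y))) := by
      rw [hwc, hbc', act_smul, inner_eq]
      simp only [cross, act_zero_coord, act_one_coord, PiLp.sub_apply, PiLp.smul_apply,
        smul_eq_mul, perp_zero, perp_one, hR.1, hR.2.1]
      ring
    rw [e1, hba, hca, cross_smul_pt]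
    have : ((i : ℝ) * l - j * k) = d := by rw [hdd]; push_cast; ring
    rw [this, show ε ^ 2 * (Real.sqrt 3 / 2) * (d : ℝ) *
      (ε * d * inner ℝ (w a - w b) (act R (perp (pt x y)))) = ε ^ 3 * (Real.sqrt 3 / 2) *
      ((d : ℝ) * d) * inner ℝ (w a - w b) (act R (perp (pt x y))) by ring, hdR]
    positivity
  rcases comb with ⟨c1, c2⟩ | ⟨c1, c2⟩ | ⟨c1, c2⟩
  · exact solve e f c1 c2 h₁
  · exact solve g h c1 c2 h₂
  · refine solve (e + g) (f + h) (by linarith) (by linarith) ?_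
    have : perp (pt ((e + g : ℤ) : ℝ) ((f + h : ℤ) : ℝ)) = perp (pt e f) + perp (pt g h) := by
      apply plane_ext <;> simp <;> ring
    rw [this, act_add, inner_add_right]
    exact add_pos h₁ h₂

/-! ### Piecewise affine interpolation -/

/-- The first coordinate in the basis `ε η¹, ε η²`. -/
def coordS (ε : ℝ) (x : Plane) : ℝ := (x 0 - x 1 / Real.sqrt 3) / ε

/-- The second coordinate in the basis `ε η¹, ε η²`. -/
def coordT (ε : ℝ) (x : Plane) : ℝ := 2 * x 1 / Real.sqrt 3 / ε

lemma smul_pt_coord {ε : ℝ} (hε : 0 < ε) (x : Plane) : ε • pt (coordS ε x) (coordT ε x) = x := by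
  have h3 := sqrt_three_pos
  apply plane_ext <;> simp [coordS, coordT] <;> field_simp
  ring

lemma coordS_smul_pt {ε : ℝ} (hε : 0 < ε) (s t : ℝ) : coordS ε (ε • pt s t) = s := by
  have h3 := sqrt_three_pos
  simp [coordS]; field_simp; ring

lemma coordT_smul_pt {ε : ℝ} (hε : 0 < ε) (s t : ℝ) : coordT ε (ε • pt s t) = t := by
  have h3 := sqrt_three_pos
  simp [coordT]; field_simp

lemma isLinearMap_coordS (ε : ℝ) : IsLinearMap ℝ (coordS ε) where
  map_add x y := by simp only [coordS, PiLp.add_apply]; ring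
  map_smul r x := by simp only [coordS, PiLp.smul_apply, smul_eq_mul]; ring

lemma isLinearMap_coordT (ε : ℝ) : IsLinearMap ℝ (coordT ε) where
  map_add x y := by simp only [coordT, PiLp.add_apply]; ring
  map_smul r x := by simp only [coordT, PiLp.smul_apply, smul_eq_mul]; ring

lemma isLinearMap_coordS_add_coordT (ε : ℝ) :
    IsLinearMap ℝ (fun x => coordS ε x + coordT ε x) where
  map_add x y := by rw [(isLinearMap_coordS ε).map_add, (isLinearMap_coordT ε).map_add]; ring
  map_smul r x := by
    rw [(isLinearMap_coordS ε).map_smul, (isLinearMap_coordT ε).map_smul, smul_add]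

/-- The continuous interpolation of `w` which is affine on the triangles of `L_ε`. -/
def interp (ε : ℝ) (w : Plane → Plane) (x : Plane) : Plane :=
  if Int.fract (coordS ε x) + Int.fract (coordT ε x) ≤ 1 then
    (1 - Int.fract (coordS ε x) - Int.fract (coordT ε x)) •
        w (ε • pt (⌊coordS ε x⌋ : ℤ) (⌊coordT ε x⌋ : ℤ)) +
      Int.fract (coordS ε x) • w (ε • pt (⌊coordS ε x⌋ + 1 : ℤ) (⌊coordT ε x⌋ : ℤ)) +
      Int.fract (coordT ε x) • w (ε • pt (⌊coordS ε x⌋ : ℤ) (⌊coordT ε x⌋ + 1 : ℤ))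
  else
    (Int.fract (coordS ε x) + Int.fract (coordT ε x) - 1) •
        w (ε • pt (⌊coordS ε x⌋ + 1 : ℤ) (⌊coordT ε x⌋ + 1 : ℤ)) +
      (1 - Int.fract (coordS ε x)) • w (ε • pt (⌊coordS ε x⌋ : ℤ) (⌊coordT ε x⌋ + 1 : ℤ)) +
      (1 - Int.fract (coordT ε x)) • w (ε • pt (⌊coordS ε x⌋ + 1 : ℤ) (⌊coordT ε x⌋ : ℤ))

lemma affine_comb {A : Plane →ᵃ[ℝ] Plane} {c₁ c₂ c₃ : ℝ} (h : c₁ + c₂ + c₃ = 1) (x y z : Plane) :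
    A (c₁ • x + c₂ • y + c₃ • z) = c₁ • A x + c₂ • A y + c₃ • A z := by
  have e : ∀ v, A v = A.linear v + A 0 := fun v => congrFun A.decomp v
  rw [e, e x, e y, e z]
  simp only [map_add, map_smul]
  obtain rfl : c₃ = 1 - c₁ - c₂ := by linarith
  module

lemma norm_smul_pt_sub_le {ε : ℝ} (hε : 0 < ε) {s t s' t' : ℝ} (hs : |s - s'| ≤ 1)
    (ht : |t - t'| ≤ 1) : ‖ε • pt s t - ε • pt s' t'‖ ≤ 2 * ε := by
  rw [← smul_sub, norm_smul, Real.norm_eq_abs, abs_of_pos hε, pt_sub, mul_comm]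
  refine mul_le_mul_of_nonneg_right (abs_le_of_sq_le_sq' ?_ (by norm_num)).2 hε.le
  rw [norm_sq_pt]
  have h1 := abs_le.1 hs
  have h2 := abs_le.1 ht
  nlinarith [sq_nonneg ((s - s') - (t - t'))]

/-- The value of the interpolation at `x` is a convex combination of three values at points close
to `x`, of which `x` is the same convex combination. -/
lemma interp_spec {ε : ℝ} (hε : 0 < ε) (x : Plane) :
    ∃ (y₁ y₂ y₃ : Plane) (c₁ c₂ c₃ : ℝ), (0 ≤ c₁ ∧ 0 ≤ c₂ ∧ 0 ≤ c₃) ∧ c₁ + c₂ + c₃ = 1 ∧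
      (‖y₁ - x‖ ≤ 2 * ε ∧ ‖y₂ - x‖ ≤ 2 * ε ∧ ‖y₃ - x‖ ≤ 2 * ε) ∧
      x = c₁ • y₁ + c₂ • y₂ + c₃ • y₃ ∧
      ∀ w : Plane → Plane, interp ε w x = c₁ • w y₁ + c₂ • w y₂ + c₃ • w y₃ := by
  set s := coordS ε x with hs
  set t := coordT ε x with ht
  have hx : x = ε • pt s t := (smul_pt_coord hε x).symm
  have hσ0 := Int.fract_nonneg s
  have hσ1 := (Int.fract_lt_one s).le
  have hτ0 := Int.fract_nonneg t
  have hτ1 := (Int.fract_lt_one t).le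
  have es : s = ⌊s⌋ + Int.fract s := (Int.floor_add_fract s).symm
  have et : t = ⌊t⌋ + Int.fract t := (Int.floor_add_fract t).symm
  have d0 : ∀ z : ℝ, |(⌊z⌋ : ℝ) - z| ≤ 1 := fun z => by
    have := Int.floor_le z; have := Int.lt_floor_add_one z
    rw [abs_le]; constructor <;> linarith
  have d1 : ∀ z : ℝ, |((⌊z⌋ + 1 : ℤ) : ℝ) - z| ≤ 1 := fun z => by
    have := Int.floor_le z; have := Int.lt_floor_add_one z
    push_cast
    rw [abs_le]; constructor <;> linarith
  have hn : ∀ p q : ℝ, |p - s| ≤ 1 → |q - t| ≤ 1 → ‖ε • pt p q - x‖ ≤ 2 * ε := by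
    intro p q hp hq
    rw [hx]; exact norm_smul_pt_sub_le hε hp hq
  by_cases h : Int.fract s + Int.fract t ≤ 1
  · refine ⟨ε • pt (⌊s⌋ : ℤ) (⌊t⌋ : ℤ), ε • pt (⌊s⌋ + 1 : ℤ) (⌊t⌋ : ℤ),
      ε • pt (⌊s⌋ : ℤ) (⌊t⌋ + 1 : ℤ), 1 - Int.fract s - Int.fract t, Int.fract s, Int.fract t,
      ⟨by linarith, hσ0, hτ0⟩, by ring, ⟨hn _ _ (d0 s) (d0 t), hn _ _ (d1 s) (d0 t),
      hn _ _ (d0 s) (d1 t)⟩, ?_, fun w => ?_⟩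
    · conv_lhs => rw [hx]
      apply plane_ext <;> simp
      · linear_combination ε * es + ε / 2 * et
      · linear_combination ε * (Real.sqrt 3 / 2) * et
    · rw [interp, ← hs, ← ht, if_pos h]
  · refine ⟨ε • pt (⌊s⌋ + 1 : ℤ) (⌊t⌋ + 1 : ℤ), ε • pt (⌊s⌋ : ℤ) (⌊t⌋ + 1 : ℤ),
      ε • pt (⌊s⌋ + 1 : ℤ) (⌊t⌋ : ℤ), Int.fract s + Int.fract t - 1, 1 - Int.fract s,
      1 - Int.fract t,
      ⟨by linarith, by linarith, by linarith⟩, by ring, ⟨hn _ _ (d1 s) (d1 t),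
      hn _ _ (d0 s) (d1 t), hn _ _ (d1 s) (d0 t)⟩, ?_, fun w => ?_⟩
    · conv_lhs => rw [hx]
      apply plane_ext <;> simp
      · linear_combination ε * es + ε / 2 * et
      · linear_combination ε * (Real.sqrt 3 / 2) * et
    · rw [interp, ← hs, ← ht, if_neg h]

lemma interp_eq_affine {ε : ℝ} (hε : 0 < ε) {w : Plane → Plane} {x : Plane}
    {A : Plane →ᵃ[ℝ] Plane} (h : ∀ y, ‖y - x‖ ≤ 2 * ε → w y = A y) : interp ε w x = A x := by
  obtain ⟨y₁, y₂, y₃, c₁, c₂, c₃, -, hsum, ⟨h1, h2, h3⟩, hx, hw⟩ := interp_spec hε x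
  rw [hw, h _ h1, h _ h2, h _ h3, ← affine_comb hsum, ← hx]

lemma norm_interp_le {ε : ℝ} (hε : 0 < ε) {w : Plane → Plane} {x : Plane} {M : ℝ}
    (h : ∀ y, ‖y - x‖ ≤ 2 * ε → ‖w y‖ ≤ M) : ‖interp ε w x‖ ≤ M := by
  obtain ⟨y₁, y₂, y₃, c₁, c₂, c₃, ⟨p1, p2, p3⟩, hsum, ⟨h1, h2, h3⟩, -, hw⟩ := interp_spec hε x
  rw [hw]
  have e : ∀ (c : ℝ) (y : Plane), 0 ≤ c → ‖y - x‖ ≤ 2 * ε → ‖c • w y‖ ≤ c * M := by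
    intro c y hc hy
    rw [norm_smul, Real.norm_eq_abs, abs_of_nonneg hc]
    exact mul_le_mul_of_nonneg_left (h y hy) hc
  calc _ ≤ ‖c₁ • w y₁‖ + ‖c₂ • w y₂‖ + ‖c₃ • w y₃‖ := norm_add₃_le
    _ ≤ c₁ * M + c₂ * M + c₃ * M := add_le_add_three (e _ _ p1 h1) (e _ _ p2 h2) (e _ _ p3 h3)
    _ = M := by rw [← add_mul, ← add_mul, hsum, one_mul]

lemma measurable_coordS (ε : ℝ) : Measurable (coordS ε) := by unfold coordS; fun_prop
lemma measurable_coordT (ε : ℝ) : Measurable (coordT ε) := by unfold coordT; fun_prop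

lemma measurable_interp (ε : ℝ) (w : Plane → Plane) : Measurable (interp ε w) := by
  have hs := measurable_coordS ε
  have ht := measurable_coordT ε
  have hfl : Measurable fun x => (⌊coordS ε x⌋, ⌊coordT ε x⌋) :=
    (Int.measurable_floor.comp hs).prodMk (Int.measurable_floor.comp ht)
  have hw : ∀ F : ℤ × ℤ → Plane, Measurable fun x => F (⌊coordS ε x⌋, ⌊coordT ε x⌋) :=
    fun F => (Measurable.of_discrete (f := F)).comp hfl
  have h00 := hw fun p => w (ε • pt p.1 p.2)
  have h10 := hw fun p => w (ε • pt (p.1 + 1 : ℤ) p.2)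
  have h01 := hw fun p => w (ε • pt p.1 (p.2 + 1 : ℤ))
  have h11 := hw fun p => w (ε • pt (p.1 + 1 : ℤ) (p.2 + 1 : ℤ))
  have fs : Measurable fun x => Int.fract (coordS ε x) := measurable_fract.comp hs
  have ft : Measurable fun x => Int.fract (coordT ε x) := measurable_fract.comp ht
  unfold interp
  refine Measurable.ite (measurableSet_le (fs.add ft) measurable_const) ?_ ?_
  · exact ((((measurable_const.sub fs).sub ft).smul h00).add (fs.smul h10)).add (ft.smul h01)
  · exact ((((fs.add ft).sub measurable_const).smul h11).add
      ((measurable_const.sub fs).smul h01)).add ((measurable_const.sub ft).smul h10)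

/-! ### The interpolation on lattice triangles -/

lemma exists_affine_coords (A : Plane →ᵃ[ℝ] Plane) (ε : ℝ) :
    ∃ p q r : Plane, ∀ s t : ℝ, A (ε • pt s t) = s • p + t • q + r := by
  refine ⟨A.linear (ε • eta1), A.linear (ε • eta2), A 0, fun s t => ?_⟩
  rw [show A (ε • pt s t) = A.linear (ε • pt s t) + A 0 from congrFun A.decomp _, pt]
  simp only [map_add, map_smul, smul_add]
  rw [smul_comm ε s, smul_comm ε t]

lemma interp_eq_of_coord {ε : ℝ} {w : Plane → Plane} {x : Plane} {m n : ℤ}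
    {σ τ : ℝ} (hσ : 0 ≤ σ ∧ σ < 1) (hτ : 0 ≤ τ ∧ τ < 1) (hs : coordS ε x = m + σ)
    (ht : coordT ε x = n + τ) :
    interp ε w x = if σ + τ ≤ 1 then
      (1 - σ - τ) • w (ε • pt m n) + σ • w (ε • pt (m + 1 : ℤ) n) + τ • w (ε • pt m (n + 1 : ℤ))
    else (σ + τ - 1) • w (ε • pt (m + 1 : ℤ) (n + 1 : ℤ)) + (1 - σ) • w (ε • pt m (n + 1 : ℤ)) +
      (1 - τ) • w (ε • pt (m + 1 : ℤ) n) := by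
  have f1 : ⌊coordS ε x⌋ = m := by
    rw [hs, Int.floor_eq_iff]; constructor <;> linarith
  have f2 : ⌊coordT ε x⌋ = n := by
    rw [ht, Int.floor_eq_iff]; constructor <;> linarith
  have g1 : Int.fract (coordS ε x) = σ := by rw [Int.fract, f1, hs]; ring
  have g2 : Int.fract (coordT ε x) = τ := by rw [Int.fract, f2, ht]; ring
  rw [interp, f1, f2, g1, g2]

/-- In the closed upward triangle the integer parts jump only at two vertices, which are treated as
corners of neighbouring cells. -/
lemma interp_up {ε : ℝ} (hε : 0 < ε) {w : Plane → Plane} {A : Plane →ᵃ[ℝ] Plane} {m n : ℤ}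
    (h00 : A (ε • pt m n) = w (ε • pt m n))
    (h10 : A (ε • pt (m + 1 : ℤ) n) = w (ε • pt (m + 1 : ℤ) n))
    (h01 : A (ε • pt m (n + 1 : ℤ)) = w (ε • pt m (n + 1 : ℤ)))
    {x : Plane} (hs : m ≤ coordS ε x) (ht : n ≤ coordT ε x)
    (hst : coordS ε x + coordT ε x ≤ m + n + 1) : interp ε w x = A x := by
  obtain ⟨p, q, r, hA⟩ := exists_affine_coords A ε
  have hx : A x = coordS ε x • p + coordT ε x • q + r := by
    conv_lhs => rw [← smul_pt_coord hε x]
    exact hA _ _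
  rcases lt_or_eq_of_le (show coordS ε x ≤ m + 1 by linarith) with h1 | h1
  · rcases lt_or_eq_of_le (show coordT ε x ≤ n + 1 by linarith) with h2 | h2
    · rw [interp_eq_of_coord (m := m) (n := n) (σ := coordS ε x - m) (τ := coordT ε x - n)
        ⟨by linarith, by linarith⟩ ⟨by linarith, by linarith⟩ (by ring) (by ring),
        if_pos (by linarith), ← h00, ← h10, ← h01, hA, hA, hA, hx]
      push_cast
      module
    · have h3 : coordS ε x = m := by linarith
      rw [interp_eq_of_coord (m := m) (n := n + 1) (σ := 0) (τ := 0)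
        ⟨le_rfl, one_pos⟩ ⟨le_rfl, one_pos⟩ (by rw [h3]; ring) (by rw [h2]; push_cast; ring),
        if_pos (by norm_num), ← h01, hA, hx, h3, h2]
      push_cast
      module
  · have h3 : coordT ε x = n := by linarith
    rw [interp_eq_of_coord (m := m + 1) (n := n) (σ := 0) (τ := 0)
      ⟨le_rfl, one_pos⟩ ⟨le_rfl, one_pos⟩ (by rw [h1]; push_cast; ring) (by rw [h3]; ring),
      if_pos (by norm_num), ← h10, hA, hx, h3, h1]
    push_cast
    module

/-- Two edges of the closed downward triangle belong to neighbouring cells, and its diagonal edge is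
evaluated by the formula for upward triangles; the formulas agree there because each uses only the
values at the ends of the edge. -/
lemma interp_down {ε : ℝ} (hε : 0 < ε) {w : Plane → Plane} {A : Plane →ᵃ[ℝ] Plane} {m n : ℤ}
    (h11 : A (ε • pt (m + 1 : ℤ) (n + 1 : ℤ)) = w (ε • pt (m + 1 : ℤ) (n + 1 : ℤ)))
    (h10 : A (ε • pt (m + 1 : ℤ) n) = w (ε • pt (m + 1 : ℤ) n))
    (h01 : A (ε • pt m (n + 1 : ℤ)) = w (ε • pt m (n + 1 : ℤ)))
    {x : Plane} (hs : coordS ε x ≤ m + 1) (ht : coordT ε x ≤ n + 1)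
    (hst : m + n + 1 ≤ coordS ε x + coordT ε x) : interp ε w x = A x := by
  obtain ⟨p, q, r, hA⟩ := exists_affine_coords A ε
  have hx : A x = coordS ε x • p + coordT ε x • q + r := by
    conv_lhs => rw [← smul_pt_coord hε x]
    exact hA _ _
  rcases lt_or_eq_of_le hs with h1 | h1
  · rcases lt_or_eq_of_le ht with h2 | h2
    · rw [interp_eq_of_coord (m := m) (n := n) (σ := coordS ε x - m) (τ := coordT ε x - n)
        ⟨by linarith, by linarith⟩ ⟨by linarith, by linarith⟩ (by ring) (by ring),
        ← h11, ← h10, ← h01, hA, hA, hA, hx]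
      split_ifs with hle
      · have : coordT ε x = m + n + 1 - coordS ε x := by linarith
        rw [this]
        push_cast
        rw [show (1 - (coordS ε x - m) - (m + n + 1 - coordS ε x - n) : ℝ) = 0 by ring]
        module
      · push_cast
        module
    · rw [interp_eq_of_coord (m := m) (n := n + 1) (σ := coordS ε x - m) (τ := 0)
        ⟨by linarith, by linarith⟩ ⟨le_rfl, one_pos⟩ (by ring) (by rw [h2]; push_cast; ring),
        if_pos (by linarith), ← h01, ← h11, hA, hA, hx, h2]
      push_cast
      module
  · rcases lt_or_eq_of_le ht with h2 | h2
    · rw [interp_eq_of_coord (m := m + 1) (n := n) (σ := 0) (τ := coordT ε x - n)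
        ⟨le_rfl, one_pos⟩ ⟨by linarith, by linarith⟩ (by rw [h1]; push_cast; ring) (by ring),
        if_pos (by linarith), ← h10, ← h11, hA, hA, hx, h1]
      push_cast
      module
    · rw [interp_eq_of_coord (m := m + 1) (n := n + 1) (σ := 0) (τ := 0)
        ⟨le_rfl, one_pos⟩ ⟨le_rfl, one_pos⟩ (by rw [h1]; push_cast; ring)
        (by rw [h2]; push_cast; ring),
        if_pos (by norm_num), ← h11, hA, hx, h1, h2]
      push_cast
      module

lemma triple_eq_iff (p₁ p₂ p₃ q₁ q₂ q₃ : ℤ × ℤ) :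
    ({p₁, p₂, p₃} : Set (ℤ × ℤ)) = {q₁, q₂, q₃} ↔
      ∀ x y : ℤ, (x = p₁.1 ∧ y = p₁.2 ∨ x = p₂.1 ∧ y = p₂.2 ∨ x = p₃.1 ∧ y = p₃.2) ↔
        (x = q₁.1 ∧ y = q₁.2 ∨ x = q₂.1 ∧ y = q₂.2 ∨ x = q₃.1 ∧ y = q₃.2) := by
  simp [Set.ext_iff, Prod.ext_iff]

/-- Every unit lattice triangle points upwards or downwards. -/
lemma HexUnit.exists_up_or_down {i j k l : ℤ} (h : HexUnit i j) (h' : HexUnit k l)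
    (h'' : HexUnit (k - i) (l - j)) (m n : ℤ) : ∃ m' n' : ℤ,
      ({(m, n), (m + i, n + j), (m + k, n + l)} : Set (ℤ × ℤ)) =
        {(m', n'), (m' + 1, n'), (m', n' + 1)} ∨
      ({(m, n), (m + i, n + j), (m + k, n + l)} : Set (ℤ × ℤ)) =
        {(m' + 1, n' + 1), (m' + 1, n'), (m', n' + 1)} := by
  simp only [triple_eq_iff]
  rcases h.cases with ⟨rfl, rfl⟩ | ⟨rfl, rfl⟩ | ⟨rfl, rfl⟩ | ⟨rfl, rfl⟩ | ⟨rfl, rfl⟩ | ⟨rfl, rfl⟩ <;>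
  rcases h'.cases with ⟨rfl, rfl⟩ | ⟨rfl, rfl⟩ | ⟨rfl, rfl⟩ | ⟨rfl, rfl⟩ | ⟨rfl, rfl⟩ | ⟨rfl, rfl⟩ <;>
  first
  | (exfalso; revert h''; simp [HexUnit]; done)
  | (refine ⟨m, n, ?_⟩; first | (left; intro x y; omega) | (right; intro x y; omega))
  | (refine ⟨m - 1, n, ?_⟩; first | (left; intro x y; omega) | (right; intro x y; omega))
  | (refine ⟨m, n - 1, ?_⟩; first | (left; intro x y; omega) | (right; intro x y; omega))
  | (refine ⟨m - 1, n - 1, ?_⟩; first | (left; intro x y; omega) | (right; intro x y; omega))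

/-- On a lattice triangle the interpolation is the affine function with the given values at the
vertices. -/
lemma interp_eq_on_triangle {Ω : Set Plane} {ε : ℝ} (hε : 0 < ε) {a b c : Plane}
    (hT : IsTriangleIn Ω ε a b c) {w : Plane → Plane} {A : Plane →ᵃ[ℝ] Plane}
    (ha : A a = w a) (hb : A b = w b) (hc : A c = w c) {x : Plane}
    (hx : x ∈ convexHull ℝ {a, b, c}) : interp ε w x = A x := by
  obtain ⟨m, n, i, j, k, l, ha', hb', hc', hij, hkl, hd⟩ := hT.exists_coords hε
  obtain ⟨m', n', h⟩ := hij.exists_up_or_down hkl hd m n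
  let f : ℤ × ℤ → Plane := fun p => ε • pt p.1 p.2
  have hset : ({a, b, c} : Set Plane) = f '' {(m, n), (m + i, n + j), (m + k, n + l)} := by
    simp only [Set.image_insert_eq, Set.image_singleton, f, ha', hb', hc']
  have hA : ∀ y ∈ ({a, b, c} : Set Plane), A y = w y := by
    rintro y (rfl | rfl | rfl) <;> assumption
  rw [hset] at hA hx
  rcases h with h | h <;> rw [h] at hA hx <;>
    simp only [Set.image_insert_eq, Set.image_singleton, f, Set.forall_mem_insert] at hA hx
  · have hsub : ∀ y ∈ convexHull ℝ ({ε • pt m' n', ε • pt (m' + 1 : ℤ) n',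
        ε • pt m' (n' + 1 : ℤ)} : Set Plane),
        y ∈ {y | (m' : ℝ) ≤ coordS ε y} ∩ {y | (n' : ℝ) ≤ coordT ε y} ∩
          {y | coordS ε y + coordT ε y ≤ m' + n' + 1} := by
      apply convexHull_min
      · rintro y (rfl | rfl | rfl) <;>
          simp only [Set.mem_inter_iff, Set.mem_ofPred_eq, coordS_smul_pt hε, coordT_smul_pt hε] <;>
          push_cast <;> refine ⟨⟨?_, ?_⟩, ?_⟩ <;> linarith
      · exact ((convex_halfSpace_ge (isLinearMap_coordS ε) _).inter
          (convex_halfSpace_ge (isLinearMap_coordT ε) _)).inter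
          (convex_halfSpace_le (isLinearMap_coordS_add_coordT ε) _)
    obtain ⟨⟨h1, h2⟩, h3⟩ := hsub x hx
    exact interp_up hε hA.1 hA.2.1 (hA.2.2 _ rfl) h1 h2 h3
  · have hsub : ∀ y ∈ convexHull ℝ ({ε • pt (m' + 1 : ℤ) (n' + 1 : ℤ), ε • pt (m' + 1 : ℤ) n',
        ε • pt m' (n' + 1 : ℤ)} : Set Plane),
        y ∈ {y | coordS ε y ≤ m' + 1} ∩ {y | coordT ε y ≤ n' + 1} ∩
          {y | (m' + n' + 1 : ℝ) ≤ coordS ε y + coordT ε y} := by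
      apply convexHull_min
      · rintro y (rfl | rfl | rfl) <;>
          simp only [Set.mem_inter_iff, Set.mem_ofPred_eq, coordS_smul_pt hε, coordT_smul_pt hε] <;>
          push_cast <;> refine ⟨⟨?_, ?_⟩, ?_⟩ <;> linarith
      · exact ((convex_halfSpace_le (isLinearMap_coordS ε) _).inter
          (convex_halfSpace_le (isLinearMap_coordT ε) _)).inter
          (convex_halfSpace_ge (isLinearMap_coordS_add_coordT ε) _)
    obtain ⟨⟨h1, h2⟩, h3⟩ := hsub x hx
    exact interp_down hε hA.1 hA.2.1 (hA.2.2 _ rfl) h1 h2 h3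

lemma isInterpolation_interp {ε : ℝ} (hε : 0 < ε) (Ω : Set Plane) (w : Plane → Plane) :
    IsInterpolation Ω ε w (interp ε w) := by
  intro a b c hT
  obtain ⟨A, h1, h2, h3, -⟩ :=
    exists_affineMap_of_cross_ne_zero (hT.cross_ne_zero hε) (w a) (w b) (w c)
  refine ⟨A, h1, h2, h3, ?_⟩
  have hm : MeasurableSet (convexHull ℝ ({a, b, c} : Set Plane)) :=
    (Set.Finite.isCompact_convexHull (𝕜 := ℝ) (by simp)).measurableSet
  exact (ae_restrict_iff' hm).2 (Eventually.of_forall fun x hx =>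
    interp_eq_on_triangle hε hT h1 h2 h3 hx)

/-! ### The recovery sequence -/

section TwoPiece

variable {Rp Rm : Matrix (Fin 2) (Fin 2) ℝ} {x₀ ν qp qm : Plane}

lemma twoPiece_of_pos {x : Plane} (h : 0 < inner ℝ (x - x₀) ν) :
    twoPiece Rp Rm x₀ ν qp qm x = act Rp x + qp := by rw [twoPiece, if_pos h]

lemma twoPiece_of_nonpos {x : Plane} (h : inner ℝ (x - x₀) ν ≤ 0) :
    twoPiece Rp Rm x₀ ν qp qm x = act Rm x + qm := by rw [twoPiece, if_neg h.not_gt]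

lemma norm_twoPiece_le (hRp : IsRot Rp) (hRm : IsRot Rm) (x : Plane) :
    ‖twoPiece Rp Rm x₀ ν qp qm x‖ ≤ ‖x‖ + (‖qp‖ + ‖qm‖) := by
  have h1 := norm_nonneg qp
  have h2 := norm_nonneg qm
  rcases lt_or_ge 0 (inner ℝ (x - x₀) ν) with h | h
  · rw [twoPiece_of_pos h]
    have := norm_add_le (act Rp x) qp
    rw [hRp.norm_act] at this; linarith
  · rw [twoPiece_of_nonpos h]
    have := norm_add_le (act Rm x) qm
    rw [hRm.norm_act] at this; linarith

lemma measurable_twoPiece : Measurable (twoPiece Rp Rm x₀ ν qp qm) := by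
  unfold twoPiece
  refine Measurable.ite (measurableSet_lt measurable_const ?_) ?_ ?_
  · exact (by fun_prop : Continuous fun x : Plane => inner ℝ (x - x₀) ν).measurable
  · exact ((continuous_act Rp).add continuous_const).measurable
  · exact ((continuous_act Rm).add continuous_const).measurable

lemma volume_line_eq_zero (hν : ν ≠ 0) : volume {x : Plane | inner ℝ (x - x₀) ν = 0} = 0 := by
  have h := Measure.addHaar_affineSubspace (volume : Measure Plane)
    (AffineSubspace.mk' x₀ (Submodule.span ℝ {ν})ᗮ) (fun h => by
      have h1 : x₀ + ν ∈ AffineSubspace.mk' x₀ (Submodule.span ℝ {ν})ᗮ := by rw [h]; trivial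
      rw [AffineSubspace.mem_mk', Submodule.mem_orthogonal_singleton_iff_inner_left] at h1
      simp at h1
      exact hν h1)
  convert h using 2
  ext x
  simp only [SetLike.mem_coe, AffineSubspace.mem_mk',
    Submodule.mem_orthogonal_singleton_iff_inner_left, vsub_eq_sub]
  rfl

/-- The interpolation of `w` on the lattice of size `ε`, for small `ε`. -/
def recovery (w : Plane → Plane) (ε : ℝ) : Plane → Plane := if ε ≤ 1 then interp ε w else w

/-- A small ball around a point off the line lies on one side. Once `2ε` is below its radius, all
sampled vertices obey the same rigid motion, which affine interpolation reproduces exactly. -/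
lemma interp_twoPiece_eventually_eq {x : Plane} (hx : inner ℝ (x - x₀) ν ≠ 0) :
    ∀ᶠ ε in 𝓝[>] (0 : ℝ), interp ε (twoPiece Rp Rm x₀ ν qp qm) x =
      twoPiece Rp Rm x₀ ν qp qm x := by
  have hc : Continuous fun y : Plane => inner ℝ (y - x₀) ν := by fun_prop
  have small : ∀ ρ : ℝ, 0 < ρ → ∀ᶠ ε in 𝓝[>] (0 : ℝ), 0 < ε ∧ 2 * ε < ρ := by
    intro ρ hρ
    filter_upwards [self_mem_nhdsWithin, mem_nhdsWithin_of_mem_nhds (Iio_mem_nhds (half_pos hρ))]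
      with ε h1 h2
    exact ⟨h1, by have : ε < ρ / 2 := h2; linarith⟩
  rcases lt_or_gt_of_ne hx with h | h
  · obtain ⟨ρ, hρ, hball⟩ := Metric.mem_nhds_iff.1 ((isOpen_lt hc continuous_const).mem_nhds h)
    filter_upwards [small ρ hρ] with ε hε
    rw [twoPiece_of_nonpos h.le, ← rigid_apply]
    refine interp_eq_affine hε.1 fun y hy => ?_
    rw [rigid_apply, twoPiece_of_nonpos]
    exact le_of_lt (hball (show y ∈ Metric.ball x ρ by
      rw [Metric.mem_ball, dist_eq_norm]; linarith [hε.2]))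
  · obtain ⟨ρ, hρ, hball⟩ := Metric.mem_nhds_iff.1 ((isOpen_lt continuous_const hc).mem_nhds h)
    filter_upwards [small ρ hρ] with ε hε
    rw [twoPiece_of_pos h, ← rigid_apply]
    refine interp_eq_affine hε.1 fun y hy => ?_
    rw [rigid_apply, twoPiece_of_pos]
    exact hball (show y ∈ Metric.ball x ρ by
      rw [Metric.mem_ball, dist_eq_norm]; linarith [hε.2])

lemma measurable_recovery (ε : ℝ) :
    Measurable (recovery (twoPiece Rp Rm x₀ ν qp qm) ε) := by
  unfold recovery
  split_ifs
  · exact measurable_interp _ _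
  · exact measurable_twoPiece

/-- The `2` is the distance `2ε` to the sampled vertices when `ε ≤ 1`. For larger `ε` no
interpolation is made, which keeps the bound uniform over all `ε > 0`, as `ConvergesTo` demands. -/
lemma norm_recovery_le (hRp : IsRot Rp) (hRm : IsRot Rm) {ε B : ℝ} (hε : 0 < ε) {x : Plane}
    (hx : ‖x‖ ≤ B) :
    ‖recovery (twoPiece Rp Rm x₀ ν qp qm) ε x‖ ≤ B + 2 + (‖qp‖ + ‖qm‖) := by
  unfold recovery
  split_ifs with h
  · refine norm_interp_le hε fun y hy => (norm_twoPiece_le hRp hRm y).trans ?_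
    have : ‖y‖ ≤ ‖y - x‖ + ‖x‖ := by simpa using norm_add_le (y - x) x
    linarith
  · refine (norm_twoPiece_le hRp hRm x).trans ?_
    linarith

lemma convergesTo_recovery {Ω : Set Plane} (hΩ : IsOpen Ω) (hb : Bornology.IsBounded Ω)
    (hRp : IsRot Rp) (hRm : IsRot Rm) (hν : ν ≠ 0) {u : Plane → Plane}
    (hu : ∀ x ∈ Ω, u x = twoPiece Rp Rm x₀ ν qp qm x) :
    ConvergesTo Ω (recovery (twoPiece Rp Rm x₀ ν qp qm)) u := by
  obtain ⟨B, hB⟩ := hb.exists_norm_le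
  set M := B + 2 + (‖qp‖ + ‖qm‖) with hM
  set w := twoPiece Rp Rm x₀ ν qp qm with hw
  have hfin : volume Ω ≠ ∞ := hb.measure_lt_top.ne
  have : IsFiniteMeasure (volume.restrict Ω) := ⟨by simpa using hb.measure_lt_top⟩
  have hbound : ∀ ε : ℝ, 0 < ε → ∀ᵐ x ∂(volume.restrict Ω), ‖recovery w ε x‖ ≤ M :=
    fun ε hε => (ae_restrict_iff' hΩ.measurableSet).2
      (Eventually.of_forall fun x hx => norm_recovery_le hRp hRm hε (hB x hx))
  refine ⟨fun ε hε => ?_, ⟨M.toNNReal, fun ε hε => ?_⟩, ?_⟩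
  · exact Integrable.of_bound (measurable_recovery ε).aestronglyMeasurable M (hbound ε hε)
  · rw [eLpNorm_exponent_top]
    exact eLpNormEssSup_le_of_ae_bound (hbound ε hε)
  · have hcongr : ∀ ε : ℝ, eLpNorm (fun x => recovery w ε x - u x) 1 (volume.restrict Ω) =
        ∫⁻ x in Ω, ‖recovery w ε x - w x‖ₑ := fun ε => by
      rw [eLpNorm_one_eq_lintegral_enorm]
      exact setLIntegral_congr_fun hΩ.measurableSet fun x hx => by simp only [hu x hx]
    simp only [hcongr]
    have hlim := tendsto_lintegral_filter_of_dominated_convergence (μ := volume.restrict Ω)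
      (l := 𝓝[>] (0 : ℝ)) (F := fun ε x => ‖recovery w ε x - w x‖ₑ) (f := fun _ => 0)
      (fun _ => ENNReal.ofReal (2 * M)) ?_ ?_ ?_ ?_
    · simpa using hlim
    · exact Eventually.of_forall fun ε =>
        ((measurable_recovery ε).sub measurable_twoPiece).enorm
    · filter_upwards [self_mem_nhdsWithin] with ε hε
      refine (ae_restrict_iff' hΩ.measurableSet).2 (Eventually.of_forall fun x hx => ?_)
      rw [← ofReal_norm]
      refine ENNReal.ofReal_le_ofReal ((norm_sub_le _ _).trans ?_)
      have h1 := norm_recovery_le (x₀ := x₀) (ν := ν) (qp := qp) (qm := qm) hRp hRm hε (hB x hx)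
      have h2 := norm_twoPiece_le (x₀ := x₀) (ν := ν) (qp := qp) (qm := qm) hRp hRm x
      have h3 := hB x hx
      linarith
    · simp [lintegral_const, ENNReal.mul_ne_top, hfin]
    · have hae : ∀ᵐ x ∂(volume : Measure Plane), inner ℝ (x - x₀) ν ≠ 0 := by
        rw [ae_iff]; simpa using volume_line_eq_zero (x₀ := x₀) hν
      filter_upwards [ae_restrict_of_ae hae] with x hx
      refine tendsto_const_nhds.congr' ?_
      filter_upwards [interp_twoPiece_eventually_eq (Rp := Rp) (Rm := Rm) (qp := qp) (qm := qm) hx,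
        mem_nhdsWithin_of_mem_nhds (Iio_mem_nhds one_pos)] with ε h1 h2
      have h2' : ε ≤ 1 := le_of_lt h2
      rw [recovery, if_pos h2', hw, h1, sub_self, enorm_zero]

end TwoPiece

/-! ### Traces and jumps -/

lemma norm_setAverage_le {s : Set Plane} {f : Plane → ℝ} {C : ℝ} (hC : 0 ≤ C)
    (hs : volume s < ∞) (hf : ∀ y ∈ s, ‖f y‖ ≤ C) : ‖⨍ y in s, f y‖ ≤ C := by
  rw [setAverage_eq, norm_smul, norm_inv, Real.norm_of_nonneg measureReal_nonneg]
  have h := norm_setIntegral_le_of_norm_le_const hs hf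
  rcases eq_or_ne (volume.real s) 0 with h0 | h0
  · simp [h0, hC]
  · rw [inv_mul_le_iff₀ (lt_of_le_of_ne measureReal_nonneg (Ne.symm h0)), mul_comm]
    exact h

lemma isTrace_of_rigid {u : Plane → Plane} {x n q : Plane} {R : Matrix (Fin 2) (Fin 2) ℝ}
    (hR : IsRot R) {ρ : ℝ} (hρ : 0 < ρ)
    (hu : ∀ y ∈ Metric.ball x ρ, 0 < inner ℝ (y - x) n → u y = act R y + q) :
    IsTrace u x n (act R x + q) := by
  have h0 : Tendsto (fun r : ℝ => r) (𝓝[>] 0) (𝓝 0) := tendsto_id.mono_left nhdsWithin_le_nhds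
  refine squeeze_zero_norm' ?_ h0
  filter_upwards [self_mem_nhdsWithin, mem_nhdsWithin_of_mem_nhds (Iio_mem_nhds hρ)] with r hr hrρ
  have hr' : 0 < r := hr
  refine norm_setAverage_le hr'.le
    ((measure_mono Set.inter_subset_left).trans_lt measure_ball_lt_top) fun y hy => ?_
  have hyr : ‖y - x‖ < r := by rw [← dist_eq_norm]; exact hy.1
  rw [hu y (Metric.ball_subset_ball (le_of_lt hrρ) hy.1) hy.2, add_sub_add_right_eq_sub, ← act_sub,
    hR.norm_act, norm_norm]
  exact hyr.le

/-- An approximate limit agrees with the trace of a rigid deformation from either side. -/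
lemma eq_of_approxLimit {u : Plane → Plane} {x n q z : Plane} {R : Matrix (Fin 2) (Fin 2) ℝ}
    (hR : IsRot R) (hn : ‖n‖ = 1) {ρ : ℝ} (hρ : 0 < ρ) (hint : IntegrableOn u (Metric.ball x ρ))
    (hu : ∀ y ∈ Metric.ball x ρ, 0 < inner ℝ (y - x) n → u y = act R y + q)
    (hz : Tendsto (fun r : ℝ => ⨍ y in Metric.ball x r, ‖u y - z‖) (𝓝[>] 0) (𝓝 0)) :
    act R x + q = z := by
  have key : ∀ᶠ r in 𝓝[>] (0 : ℝ), (1 / 4 : ℝ) * (‖act R x + q - z‖ - r) ≤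
      ⨍ y in Metric.ball x r, ‖u y - z‖ := by
    filter_upwards [self_mem_nhdsWithin, mem_nhdsWithin_of_mem_nhds (Iio_mem_nhds hρ)] with r hr hrρ
    have hr' : 0 < r := hr
    have hrρ' : r < ρ := hrρ
    -- This ball lies in `ball x r` on the side of `n` and has a quarter of its area, whence the
    -- constant `1 / 4`.
    set s := Metric.ball (x + (r / 2) • n) (r / 2) with hs
    have hsub : s ⊆ Metric.ball x r := by
      refine Metric.ball_subset_ball' ?_
      rw [dist_eq_norm, add_sub_cancel_left, norm_smul, hn, Real.norm_of_nonneg (by positivity)]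
      linarith
    have hside : ∀ y ∈ s, 0 < inner ℝ (y - x) n := by
      intro y hy
      rw [hs, Metric.mem_ball, dist_eq_norm] at hy
      have h1 : y - x = (r / 2) • n + (y - (x + (r / 2) • n)) := by abel
      have h2 := abs_real_inner_le_norm (y - (x + (r / 2) • n)) n
      rw [hn, mul_one] at h2
      have h3 := (abs_le.1 h2).1
      rw [h1, inner_add_left, inner_smul_left, real_inner_self_eq_norm_sq, hn]
      simp only [conj_trivial]
      linarith
    -- Integrability rules out the default value `0` of the average, for which the lower bound could
    -- fail.
    have hintr : IntegrableOn (fun y => ‖u y - z‖) (Metric.ball x r) := by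
      refine Integrable.norm (Integrable.sub (hint.mono_set (Metric.ball_subset_ball hrρ'.le)) ?_)
      exact integrableOn_const measure_ball_lt_top.ne
    have hlow : ∀ y ∈ s, ‖act R x + q - z‖ - r ≤ ‖u y - z‖ := by
      intro y hy
      have hyr := hsub hy
      rw [hu y (Metric.ball_subset_ball hrρ'.le hyr) (hside y hy)]
      rw [Metric.mem_ball, dist_comm, dist_eq_norm, ← hR.norm_act, act_sub] at hyr
      have h1 : act R x + q - z = (act R x - act R y) + (act R y + q - z) := by abel
      have h2 := norm_add_le (act R x - act R y) (act R y + q - z)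
      rw [← h1] at h2
      linarith
    have hvol : ∀ c : Plane, ∀ a : ℝ, 0 ≤ a →
        volume.real (Metric.ball c a) = a ^ 2 * volume.real (Metric.ball (0 : Plane) 1) := by
      intro c a ha
      rw [measureReal_def, Measure.addHaar_ball volume c ha, ENNReal.toReal_mul,
        ENNReal.toReal_ofReal (by positivity)]
      simp [measureReal_def]
    have hpos : 0 < volume.real (Metric.ball (0 : Plane) 1) :=
      ENNReal.toReal_pos (Metric.measure_ball_pos _ _ one_pos).ne' measure_ball_lt_top.ne
    have h1 : volume.real s * (‖act R x + q - z‖ - r) ≤ ∫ y in s, ‖u y - z‖ := by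
      have := setIntegral_mono_on (μ := volume) (s := s)
        (f := fun _ => ‖act R x + q - z‖ - r) (g := fun y => ‖u y - z‖)
        (integrableOn_const measure_ball_lt_top.ne) (hintr.mono_set hsub) measurableSet_ball hlow
      rwa [setIntegral_const, smul_eq_mul] at this
    have h2 : ∫ y in s, ‖u y - z‖ ≤ ∫ y in Metric.ball x r, ‖u y - z‖ :=
      setIntegral_mono_set hintr (Eventually.of_forall fun y => norm_nonneg _)
        (LE.le.eventuallyLE hsub)
    rw [setAverage_eq, smul_eq_mul, hvol x r hr'.le, ← div_eq_inv_mul, le_div_iff₀ (by positivity)]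
    rw [hs, hvol _ _ (by positivity)] at h1
    linarith
  have hlim : Tendsto (fun r : ℝ => (1 / 4 : ℝ) * (‖act R x + q - z‖ - r)) (𝓝[>] 0)
      (𝓝 ((1 / 4 : ℝ) * (‖act R x + q - z‖ - 0))) :=
    (tendsto_const_nhds.sub (tendsto_id.mono_left nhdsWithin_le_nhds)).const_mul _
  have hle := le_of_tendsto_of_tendsto hlim hz key
  rw [← sub_eq_zero, ← norm_eq_zero]
  exact le_antisymm (by linarith) (norm_nonneg _)

/-! ### The jump along the interface -/

section Jump

variable {Ω : Set Plane} {Rp Rm : Matrix (Fin 2) (Fin 2) ℝ} {x₀ ν qp qm : Plane}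
  {u : Plane → Plane}

/-- The jump `(R⁺ x + q⁺) - (R⁻ x + q⁻)`. -/
def jump (Rp Rm : Matrix (Fin 2) (Fin 2) ℝ) (qp qm x : Plane) : Plane :=
  (act Rp x + qp) - (act Rm x + qm)

/-- The arclength parametrization of the line through `x₀` with normal `ν`. -/
def line (x₀ ν : Plane) (s : ℝ) : Plane := x₀ + s • perp ν

lemma inner_line_sub (s : ℝ) : inner ℝ (line x₀ ν s - x₀) ν = 0 := by
  simp [line, inner_eq]; ring

lemma eq_line (hν : ‖ν‖ = 1) {x : Plane} (h : inner ℝ (x - x₀) ν = 0) :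
    x = line x₀ ν (inner ℝ (x - x₀) (perp ν)) := by
  have hn := norm_sq_eq ν
  rw [hν] at hn
  rw [inner_eq] at h
  simp only [PiLp.sub_apply] at h
  apply plane_ext <;> simp [line, inner_eq]
  · linear_combination (x 0 - x₀ 0) * hn + ν 0 * h
  · linear_combination (x 1 - x₀ 1) * hn + ν 1 * h

lemma isometry_line (hν : ‖ν‖ = 1) : Isometry (line x₀ ν) := by
  refine Isometry.of_dist_eq fun s t => ?_
  rw [line, line, dist_add_left, dist_eq_norm, ← sub_smul, norm_smul, norm_perp, hν, mul_one,
    ← dist_eq_norm]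

lemma hausdorffMeasure_line_image (hν : ‖ν‖ = 1) (A : Set ℝ) :
    μH[1] (line x₀ ν '' A) = volume A := by
  rw [(isometry_line hν).hausdorffMeasure_image (Or.inl zero_le_one), hausdorffMeasure_real]

lemma exists_ball_sides (hΩ : IsOpen Ω) (hu : ∀ x ∈ Ω, u x = twoPiece Rp Rm x₀ ν qp qm x)
    {x : Plane} (hx : x ∈ Ω) (hl : inner ℝ (x - x₀) ν = 0) :
    ∃ ρ > 0, Metric.ball x ρ ⊆ Ω ∧
      (∀ y ∈ Metric.ball x ρ, 0 < inner ℝ (y - x) ν → u y = act Rp y + qp) ∧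
      (∀ y ∈ Metric.ball x ρ, 0 < inner ℝ (y - x) (-ν) → u y = act Rm y + qm) := by
  obtain ⟨ρ, hρ, hsub⟩ := Metric.isOpen_iff.1 hΩ x hx
  have e : ∀ y, inner ℝ (y - x₀) ν = inner ℝ (y - x) ν := by
    intro y
    rw [show y - x₀ = (y - x) + (x - x₀) by abel, inner_add_left, hl, add_zero]
  refine ⟨ρ, hρ, hsub, fun y hy h => ?_, fun y hy h => ?_⟩
  · rw [hu y (hsub hy), twoPiece_of_pos (by rwa [e])]
  · rw [inner_neg_right] at h
    rw [hu y (hsub hy), twoPiece_of_nonpos (by rw [e]; linarith)]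

/-- An approximate limit would have to equal both one-sided values, whose difference is the jump. -/
lemma mem_jumpSet_of_jump_ne_zero (hΩ : IsOpen Ω) (hRp : IsRot Rp) (hRm : IsRot Rm)
    (hν : ‖ν‖ = 1) (hu : ∀ x ∈ Ω, u x = twoPiece Rp Rm x₀ ν qp qm x)
    {x : Plane} (hx : x ∈ Ω) (hl : inner ℝ (x - x₀) ν = 0) (hj : jump Rp Rm qp qm x ≠ 0) :
    x ∈ jumpSet Ω u := by
  obtain ⟨ρ, hρ, hsub, h1, h2⟩ := exists_ball_sides hΩ hu hx hl
  refine ⟨hx, ?_⟩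
  rintro ⟨z, hz⟩
  have hint : IntegrableOn u (Metric.ball x ρ) := by
    have : IntegrableOn (twoPiece Rp Rm x₀ ν qp qm) (Metric.ball x ρ) := by
      refine Measure.integrableOn_of_bounded (M := ‖x‖ + ρ + (‖qp‖ + ‖qm‖))
        measure_ball_lt_top.ne measurable_twoPiece.aestronglyMeasurable ?_
      refine (ae_restrict_iff' measurableSet_ball).2 (Eventually.of_forall fun y hy => ?_)
      refine (norm_twoPiece_le hRp hRm y).trans ?_
      rw [Metric.mem_ball, dist_eq_norm] at hy
      have : ‖y‖ ≤ ‖y - x‖ + ‖x‖ := by simpa using norm_add_le (y - x) x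
      linarith
    exact this.congr_fun (fun y hy => (hu y (hsub hy)).symm) measurableSet_ball
  have e1 := eq_of_approxLimit hRp hν hρ hint h1 hz
  have e2 := eq_of_approxLimit hRm (by rwa [norm_neg]) hρ hint h2 hz
  exact hj (by rw [jump, e1, e2, sub_self])

/-- The condition that both sides of the interface are moved apart in direction `n`. -/
def Opening (Rp Rm : Matrix (Fin 2) (Fin 2) ℝ) (ν₁ ν₂ : Plane) (δ : ℝ) (v : Plane) : Prop :=
  δ ≤ inner ℝ v (act Rp ν₁) ∧ δ ≤ inner ℝ v (act Rm ν₁) ∧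
    δ ≤ inner ℝ v (act Rp ν₂) ∧ δ ≤ inner ℝ v (act Rm ν₂)

lemma Opening.ne_zero {ν₁ ν₂ v : Plane} {δ : ℝ} (hδ : 0 < δ) (h : Opening Rp Rm ν₁ ν₂ δ v) :
    v ≠ 0 := by
  rintro rfl
  have := h.1
  rw [inner_zero_left] at this
  linarith

lemma continuous_jump : Continuous (jump Rp Rm qp qm) :=
  ((continuous_act Rp).add continuous_const).sub ((continuous_act Rm).add continuous_const)

lemma jump_line_eq (s t : ℝ) : jump Rp Rm qp qm (line x₀ ν s) = jump Rp Rm qp qm (line x₀ ν t) +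
    (s - t) • (act Rp (perp ν) - act Rm (perp ν)) := by
  simp only [jump, line, act_add, act_smul]
  module

/-- Along the interface the jump vanishes identically or satisfies the opening condition
everywhere. -/
lemma jump_dichotomy (hΩ : IsOpen Ω) (hRp : IsRot Rp) (hRm : IsRot Rm)
    (hν : ‖ν‖ = 1) (hu : ∀ x ∈ Ω, u x = twoPiece Rp Rm x₀ ν qp qm x) {ν₁ ν₂ : Plane} {δ : ℝ}
    (hopen : ∀ᵐ x ∂(μH[1] : Measure Plane), x ∈ jumpSet Ω u →
      ∀ a b : Plane, IsTrace u x ν a → IsTrace u x (-ν) b → Opening Rp Rm ν₁ ν₂ δ (a - b)) :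
    (∀ s, line x₀ ν s ∈ Ω → jump Rp Rm qp qm (line x₀ ν s) = 0) ∨
      (∀ s, line x₀ ν s ∈ Ω → Opening Rp Rm ν₁ ν₂ δ (jump Rp Rm qp qm (line x₀ ν s))) := by
  by_contra! hcon
  obtain ⟨⟨s₀, -, hs₀'⟩, s₁, hs₁, hs₁'⟩ := hcon
  have hlc := (isometry_line (x₀ := x₀) hν).continuous
  set j : ℝ → Plane := fun s => jump Rp Rm qp qm (line x₀ ν s) with hj
  have hjc : Continuous j := continuous_jump.comp hlc
  -- An affine function with two zeros vanishes identically, which `s₀` excludes; so there is at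
  -- most one zero.
  have hnull : volume {s | j s = 0} = 0 := by
    refine Set.Subsingleton.measure_zero (fun a ha b hb => ?_) _
    by_contra hab
    have h1 := jump_line_eq (Rp := Rp) (Rm := Rm) (qp := qp) (qm := qm) (x₀ := x₀) (ν := ν) a b
    have ha' : jump Rp Rm qp qm (line x₀ ν a) = 0 := ha
    have hb' : jump Rp Rm qp qm (line x₀ ν b) = 0 := hb
    rw [ha', hb', zero_add, eq_comm, smul_eq_zero] at h1
    have h2 := h1.resolve_left (sub_ne_zero.2 hab)
    apply hs₀'
    rw [jump_line_eq s₀ b, hb', h2, smul_zero, add_zero]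
  have hbad : volume {s | ¬ (line x₀ ν s ∈ jumpSet Ω u → ∀ a b : Plane,
      IsTrace u (line x₀ ν s) ν a → IsTrace u (line x₀ ν s) (-ν) b →
        Opening Rp Rm ν₁ ν₂ δ (a - b))} = 0 := by
    rw [← hausdorffMeasure_line_image (x₀ := x₀) hν]
    refine measure_mono_null ?_ (ae_iff.1 hopen)
    rintro _ ⟨s, hs, rfl⟩
    exact hs
  -- Opening is a closed condition, so it fails on a relatively open set; being null, that set is
  -- empty.
  have hVopen : IsOpen {s | line x₀ ν s ∈ Ω ∧ ¬ Opening Rp Rm ν₁ ν₂ δ (j s)} := by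
    have hcl : ∀ v : Plane, IsClosed {s | δ ≤ inner ℝ (j s) v} := fun v =>
      isClosed_le continuous_const (hjc.inner continuous_const)
    have : IsClosed {s | Opening Rp Rm ν₁ ν₂ δ (j s)} :=
      (hcl _).inter ((hcl _).inter ((hcl _).inter (hcl _)))
    exact (hΩ.preimage hlc).inter this.isOpen_compl
  have hVnull : volume {s | line x₀ ν s ∈ Ω ∧ ¬ Opening Rp Rm ν₁ ν₂ δ (j s)} = 0 := by
    refine measure_mono_null ?_ (measure_union_null hnull hbad)
    rintro s ⟨hs, hs'⟩
    by_cases h0 : j s = 0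
    · exact Or.inl h0
    · refine Or.inr fun hgood => hs' ?_
      obtain ⟨ρ, hρ, -, h1, h2⟩ := exists_ball_sides hΩ hu hs (inner_line_sub s)
      exact hgood (mem_jumpSet_of_jump_ne_zero hΩ hRp hRm hν hu hs (inner_line_sub s) h0) _ _
        (isTrace_of_rigid hRp hρ h1) (isTrace_of_rigid hRm hρ h2)
  exact (Set.ext_iff.1 ((hVopen.measure_eq_zero_iff volume).1 hVnull) s₁).1 ⟨hs₁, hs₁'⟩

/-- The points added by the closure are limits of points of `S` lying on `∂Ω`, hence negligible. The
closure is needed because the crossing points are counted in closed thickenings. -/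
lemma volume_closure_line_preimage_le (hΩ : IsOpen Ω) (hν : ‖ν‖ = 1) {S : Set Plane} (hSΩ : S ⊆ Ω)
    (hS : μH[1] (closure S ∩ frontier Ω) = 0) (hU : ∀ s, line x₀ ν s ∈ Ω → line x₀ ν s ∈ S) :
    volume (closure {s | line x₀ ν s ∈ Ω}) ≤ μH[1] S := by
  set U := {s | line x₀ ν s ∈ Ω} with hUdef
  have h1 : volume U ≤ μH[1] S := by
    rw [← hausdorffMeasure_line_image (x₀ := x₀) hν]
    refine measure_mono ?_
    rintro _ ⟨s, hs, rfl⟩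
    exact hU s hs
  have h2 : volume (closure U \ U) = 0 := by
    rw [← hausdorffMeasure_line_image (x₀ := x₀) hν]
    refine measure_mono_null ?_ hS
    rintro _ ⟨s, ⟨hs, hs'⟩, rfl⟩
    have h3 : line x₀ ν s ∈ closure S := by
      refine closure_mono ?_
        (image_closure_subset_closure_image (isometry_line hν).continuous ⟨s, hs, rfl⟩)
      rintro _ ⟨r, hr, rfl⟩
      exact hU r hr
    refine ⟨h3, closure_mono hSΩ h3, ?_⟩
    rw [hΩ.interior_eq]
    exact hs'
  calc volume (closure U) ≤ volume (U ∪ closure U \ U) := by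
        rw [Set.union_sdiff_self]; exact measure_mono Set.subset_union_right
    _ ≤ volume U + volume (closure U \ U) := measure_union_le _ _
    _ ≤ μH[1] S := by rw [h2, add_zero]; exact h1

end Jump

/-! ### The surface energy density -/

lemma pt_mem_unitVectors {i j : ℤ} (h : HexUnit i j) : pt i j ∈ unitVectors := by
  rcases h.cases with ⟨rfl, rfl⟩ | ⟨rfl, rfl⟩ | ⟨rfl, rfl⟩ | ⟨rfl, rfl⟩ | ⟨rfl, rfl⟩ | ⟨rfl, rfl⟩
  · left; simp [pt]
  · right; left; simp [pt]
  · right; right; left; simp [pt]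
  · right; right; right; left; simp [pt]
  · right; right; right; right; left; simp [pt, eta3]; abel
  · right; right; right; right; right; simp [pt, eta3]; abel

lemma norm_of_mem_unitVectors {s : Plane} (h : s ∈ unitVectors) : ‖s‖ = 1 := by
  obtain ⟨i, j, hij, rfl⟩ := hexUnit_of_mem_unitVectors h
  have h1 : ‖pt i j‖ ^ 2 = 1 := by
    rw [norm_sq_pt]
    have : ((i * i + i * j + j * j : ℤ) : ℝ) = 1 := by rw [show i * i + i * j + j * j = 1 from hij]; simp
    push_cast at this
    linarith
  exact (pow_eq_one_iff_of_nonneg (norm_nonneg _) two_ne_zero).1 h1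

lemma neg_mem_unitVectors {s : Plane} (h : s ∈ unitVectors) : -s ∈ unitVectors := by
  simp only [unitVectors, Set.mem_insert_iff, Set.mem_singleton_iff] at h ⊢
  rcases h with rfl | rfl | rfl | rfl | rfl | rfl <;> simp

lemma norm_of_mem_coordDirections {n : Plane} (h : n ∈ coordDirections) : ‖n‖ = 1 := by
  obtain ⟨s, hs, rfl⟩ := h
  rw [norm_perp, norm_of_mem_unitVectors hs]

lemma convexHull_unitVectors_subset : convexHull ℝ unitVectors ⊆ Metric.closedBall 0 1 :=
  convexHull_min (fun s hs => by simp [norm_of_mem_unitVectors hs]) (convex_closedBall _ _)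

lemma norm_le_psi (ξ : Plane) : ‖ξ‖ ≤ psi ξ := by
  rw [psi, gauge_def]
  refine le_csInf ?_ ?_
  -- The gauge is an infimum with default value `0` on the empty set, so some dilation of the hull
  -- must contain `ξ`. The factor `|s| + |t| + 1` serves; the `1` keeps it positive when `ξ = 0`.
  · obtain ⟨s, t, rfl⟩ : ∃ s t : ℝ, ξ = pt s t := by
      refine ⟨coordS 1 ξ, coordT 1 ξ, ?_⟩
      conv_lhs => rw [← smul_pt_coord one_pos ξ, one_smul]
    have hsub := subset_convexHull ℝ unitVectors
    have key : ∀ (r : ℝ) (v : Plane), v ∈ unitVectors → ∃ v' ∈ unitVectors, r • v = |r| • v' := by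
      intro r v hv
      rcases le_total 0 r with h | h
      · exact ⟨v, hv, by rw [abs_of_nonneg h]⟩
      · exact ⟨-v, neg_mem_unitVectors hv, by rw [abs_of_nonpos h, neg_smul, smul_neg, neg_neg]⟩
    obtain ⟨v, hv, ev⟩ := key s eta1 (by simp [unitVectors])
    obtain ⟨v', hv', ev'⟩ := key t eta2 (by simp [unitVectors])
    have hr : 0 < |s| + |t| + 1 := by positivity
    have hz : (0 : Plane) ∈ convexHull ℝ unitVectors := by
      have := convex_convexHull ℝ unitVectors (hsub hv) (hsub (neg_mem_unitVectors hv))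
        (show (0 : ℝ) ≤ 1 / 2 by norm_num) (show (0 : ℝ) ≤ 1 / 2 by norm_num) (by norm_num)
      simpa using this
    refine ⟨|s| + |t| + 1, hr, ?_⟩
    refine ⟨(|s| / (|s| + |t| + 1)) • v + (|t| / (|s| + |t| + 1)) • v' +
      (1 / (|s| + |t| + 1)) • (0 : Plane), ?_, ?_⟩
    · have := (convex_convexHull ℝ unitVectors).sum_mem (t := Finset.univ)
        (w := ![|s| / (|s| + |t| + 1), |t| / (|s| + |t| + 1), 1 / (|s| + |t| + 1)])
        (z := ![v, v', 0]) (by intro i _; fin_cases i <;> simp <;> positivity)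
        (by simp [Fin.sum_univ_three]; field_simp) (by
          intro i _; fin_cases i
          · exact hsub hv
          · exact hsub hv'
          · exact hz)
      simpa [Fin.sum_univ_three] using this
    · simp only [smul_zero, add_zero, smul_add, smul_smul]
      rw [mul_div_cancel₀ _ hr.ne', mul_div_cancel₀ _ hr.ne', ← ev, ← ev', pt]
  · rintro r ⟨hr, v, hv, rfl⟩
    have h1 : ‖v‖ ≤ 1 := by simpa using convexHull_unitVectors_subset hv
    have hr' : 0 < r := hr
    simp only [norm_smul, Real.norm_of_nonneg hr'.le]
    exact mul_le_of_le_one_right hr'.le h1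

lemma psi_le_one {s : Plane} (h : s ∈ unitVectors) : psi s ≤ 1 :=
  gauge_le_one_of_mem (subset_convexHull ℝ _ h)

/-- Without this bound the real supremum in `psiStar` would take the default value `0`. -/
lemma bddAbove_psiStar (ν : Plane) : BddAbove (Set.range fun ξ : Metric.sphere (0 : Plane) 1 =>
    inner ℝ ν (ξ : Plane) / psi (ξ : Plane)) := by
  refine ⟨‖ν‖, ?_⟩
  rintro _ ⟨⟨ξ, hξ⟩, rfl⟩
  have h1 : ‖ξ‖ = 1 := by simpa using hξ
  have h2 : 1 ≤ psi ξ := h1 ▸ norm_le_psi ξ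
  have h3 := real_inner_le_norm ν ξ
  rw [h1, mul_one] at h3
  refine (div_le_iff₀ (by linarith)).2 (h3.trans ?_)
  exact le_mul_of_one_le_right (norm_nonneg _) h2

/-- Lattice unit vectors have Euclidean norm `1` and `psi` at most `1`, so `s` or `-s` is a suitable
competitor in the supremum. -/
lemma abs_inner_le_psiStar {ν s : Plane} (h : s ∈ unitVectors) : |inner ℝ s ν| ≤ psiStar ν := by
  have key : ∀ v ∈ unitVectors, 0 ≤ inner ℝ v ν → inner ℝ v ν ≤ psiStar ν := by
    intro v hv h0
    have h1 := norm_of_mem_unitVectors hv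
    have h2 : 1 ≤ psi v := h1 ▸ norm_le_psi v
    refine le_trans ?_ (le_ciSup (bddAbove_psiStar ν) ⟨v, by simpa using h1⟩)
    rw [real_inner_comm ν v] at h0
    rw [real_inner_comm ν v, le_div_iff₀ (by linarith)]
    exact mul_le_of_le_one_right h0 (psi_le_one hv)
  rcases le_total 0 (inner ℝ s ν) with h0 | h0
  · rw [abs_of_nonneg h0]; exact key s h h0
  · rw [abs_of_nonpos h0, ← inner_neg_left]
    exact key _ (neg_mem_unitVectors h) (by rw [inner_neg_left]; linarith)

/-- For real `a`, `b` the largest of `|a|`, `|b|`, `|a - b|` is half their sum. -/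
lemma sum_abs_inner_le (ν : Plane) :
    |inner ℝ (pt 1 0) ν| + |inner ℝ (pt 0 1) ν| + |inner ℝ (pt 1 (-1)) ν| ≤ 2 * psiStar ν := by
  have h1 := abs_inner_le_psiStar (ν := ν) (pt_mem_unitVectors (i := 1) (j := 0) (by norm_num [HexUnit]))
  have h2 := abs_inner_le_psiStar (ν := ν) (pt_mem_unitVectors (i := 0) (j := 1) (by norm_num [HexUnit]))
  have h3 := abs_inner_le_psiStar (ν := ν) (pt_mem_unitVectors (i := 1) (j := -1) (by norm_num [HexUnit]))
  push_cast at h1 h2 h3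
  have e : pt 1 (-1) = pt 1 0 - pt 0 1 := by rw [pt_sub]; norm_num
  rw [e, inner_sub_left] at h3 ⊢
  generalize inner ℝ (pt 1 0) ν = a at *
  generalize inner ℝ (pt 0 1) ν = b at *
  rw [abs_le] at h1 h2 h3
  rcases abs_cases a with ⟨ha, _⟩ | ⟨ha, _⟩ <;> rcases abs_cases b with ⟨hb, _⟩ | ⟨hb, _⟩ <;>
    rcases abs_cases (a - b) with ⟨hc, _⟩ | ⟨hc, _⟩ <;> rw [ha, hb, hc] <;> linarith

/-! ### Bonds crossing a line -/

/-- The segment between `a` and `b` crosses the line through `x₀` with normal `ν`. -/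
def Crosses (x₀ ν a b : Plane) : Prop :=
  (0 < inner ℝ (a - x₀) ν ∧ inner ℝ (b - x₀) ν ≤ 0) ∨
    (inner ℝ (a - x₀) ν ≤ 0 ∧ 0 < inner ℝ (b - x₀) ν)

variable {x₀ ν : Plane}

lemma Crosses.exists_mem_segment {a b : Plane} (h : Crosses x₀ ν a b) :
    ∃ θ : ℝ, 0 ≤ θ ∧ θ ≤ 1 ∧ inner ℝ (a + θ • (b - a) - x₀) ν = 0 := by
  set α := inner ℝ (a - x₀) ν with hα
  set β := inner ℝ (b - x₀) ν with hβ
  have e : ∀ θ : ℝ, inner ℝ (a + θ • (b - a) - x₀) ν = α + θ * (β - α) := by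
    intro θ
    rw [hα, hβ, ← inner_sub_left, ← real_inner_smul_left, ← inner_add_left]
    congr 1
    module
  have hne : α - β ≠ 0 := by rcases h with ⟨h1, h2⟩ | ⟨h1, h2⟩ <;> intro h0 <;> linarith
  refine ⟨α / (α - β), ?_, ?_, ?_⟩
  · rcases h with ⟨h1, h2⟩ | ⟨h1, h2⟩
    · exact div_nonneg h1.le (by linarith)
    · exact div_nonneg_of_nonpos h1 (by linarith)
  · rcases h with ⟨h1, h2⟩ | ⟨h1, h2⟩
    · rw [div_le_one (by linarith)]; linarith
    · rw [div_le_one_of_neg (by linarith)]; linarith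
  · rw [e]; field_simp; ring

lemma add_smul_sub_mem_segment (a b : Plane) {θ : ℝ} (h0 : 0 ≤ θ) (h1 : θ ≤ 1) :
    a + θ • (b - a) ∈ segment ℝ a b := by
  rw [segment_eq_image']; exact ⟨θ, ⟨h0, h1⟩, rfl⟩

/-- A crossing point of a segment contained in `Ω`. -/
lemma Crosses.exists_line {Ω : Set Plane} (hν : ‖ν‖ = 1) {a b : Plane} (h : Crosses x₀ ν a b)
    (hΩ : segment ℝ a b ⊆ Ω) : ∃ s : ℝ, line x₀ ν s ∈ Ω ∧ ‖a - line x₀ ν s‖ ≤ dist a b ∧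
      ‖b - line x₀ ν s‖ ≤ dist a b := by
  obtain ⟨θ, h0, h1, hθ⟩ := h.exists_mem_segment
  refine ⟨inner ℝ (a + θ • (b - a) - x₀) (perp ν), ?_⟩
  rw [← eq_line hν hθ]
  refine ⟨hΩ (add_smul_sub_mem_segment a b h0 h1), ?_, ?_⟩
  · rw [show a - (a + θ • (b - a)) = θ • (a - b) by module, norm_smul, Real.norm_of_nonneg h0,
      dist_eq_norm]
    exact mul_le_of_le_one_left (norm_nonneg _) h1
  · rw [show b - (a + θ • (b - a)) = (1 - θ) • (b - a) by module, norm_smul,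
      Real.norm_of_nonneg (by linarith), dist_comm, dist_eq_norm]
    exact mul_le_of_le_one_left (norm_nonneg _) (by linarith)

/-- The parameter of the intersection of the line through `x₀` with normal `ν` and the line through
`a` with direction `e`. -/
def crossParam (x₀ ν e a : Plane) : ℝ := cross e (a - x₀) / inner ℝ e ν

/-- The quantity `cross e (· - x₀)` is constant along the bond and equals `s * ⟨e, ν⟩` at `line x₀ ν
s`, so it identifies the crossing point. -/
lemma crossParam_mem {Ω : Set Plane} (hν : ‖ν‖ = 1) {ε : ℝ} {e a b : Plane}
    (he : inner ℝ e ν ≠ 0) (hab : b - a = ε • e) (h : Crosses x₀ ν a b)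
    (hΩ : segment ℝ a b ⊆ Ω) : line x₀ ν (crossParam x₀ ν e a) ∈ Ω := by
  obtain ⟨θ, h0, h1, hθ⟩ := h.exists_mem_segment
  have hy := hΩ (add_smul_sub_mem_segment a b h0 h1)
  have hl := eq_line hν hθ
  set s := inner ℝ (a + θ • (b - a) - x₀) (perp ν) with hs
  have : crossParam x₀ ν e a = s := by
    rw [crossParam, div_eq_iff he]
    have h2 : cross e (a + θ • (b - a) - x₀) = cross e (line x₀ ν s - x₀) := by rw [← hl]
    rw [hab] at h2
    simp only [cross, line, PiLp.sub_apply, PiLp.add_apply, PiLp.smul_apply, smul_eq_mul, perp_zero,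
      perp_one] at h2
    rw [inner_eq]
    simp only [cross, PiLp.sub_apply]
    linear_combination h2
  rw [this, ← hl]
  exact hy

/-- Along a lattice row the signed distance to the line is an arithmetic progression; being
monotone, it changes sign in only one step. -/
lemma eq_zero_of_cross_twice {β a : ℝ} {k : ℤ}
    (h : (0 < a ∧ a + β ≤ 0) ∨ (a ≤ 0 ∧ 0 < a + β))
    (h' : (0 < a + k * β ∧ a + k * β + β ≤ 0) ∨ (a + k * β ≤ 0 ∧ 0 < a + k * β + β)) : k = 0 := by
  by_contra hk
  rcases lt_or_gt_of_ne hk with hk | hk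
  · have hk' : (k : ℝ) ≤ -1 := by exact_mod_cast Int.le_sub_one_of_lt hk
    rcases h with ⟨h1, h2⟩ | ⟨h1, h2⟩ <;> rcases h' with ⟨h3, h4⟩ | ⟨h3, h4⟩ <;> nlinarith
  · have hk' : (1 : ℝ) ≤ k := by exact_mod_cast hk
    rcases h with ⟨h1, h2⟩ | ⟨h1, h2⟩ <;> rcases h' with ⟨h3, h4⟩ | ⟨h3, h4⟩ <;> nlinarith

/-- Distinct parallel lattice bonds crossing a line have well separated crossing points. -/
lemma eq_of_crossParam_close {ε : ℝ} (hε : 0 < ε) {i j : ℤ} (hij : HexUnit i j)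
    (he : inner ℝ (pt i j) ν ≠ 0) {a b a' b' : Plane} (ha : a ∈ lattice ε) (ha' : a' ∈ lattice ε)
    (hab : b - a = ε • pt i j) (hab' : b' - a' = ε • pt i j)
    (h : Crosses x₀ ν a b) (h' : Crosses x₀ ν a' b')
    (hclose : |crossParam x₀ ν (pt i j) a - crossParam x₀ ν (pt i j) a'| <
      ε * (Real.sqrt 3 / 2 / |inner ℝ (pt i j) ν|)) : a = a' ∧ b = b' := by
  obtain ⟨m, n, hm⟩ := mem_lattice_iff.1 ha
  obtain ⟨m', n', hm'⟩ := mem_lattice_iff.1 ha'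
  have h3 := sqrt_three_pos
  have hsub : a - a' = ε • pt ((m - m' : ℤ) : ℝ) ((n - n' : ℤ) : ℝ) := by
    rw [hm, hm', ← smul_sub, pt_sub]; push_cast; rfl
  -- The integer `i * (n - n') - j * (m - m')` counts the rows between the two bonds; closeness
  -- forces it to be `0`, so they lie on one row.
  have hcr : crossParam x₀ ν (pt i j) a - crossParam x₀ ν (pt i j) a' =
      ε * (Real.sqrt 3 / 2) * ((i * (n - n') - j * (m - m') : ℤ) : ℝ) / inner ℝ (pt i j) ν := by
    rw [crossParam, crossParam, ← sub_div]
    congr 1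
    have : cross (pt i j) (a - x₀) - cross (pt i j) (a' - x₀) = cross (pt i j) (a - a') := by
      simp only [cross, PiLp.sub_apply]; ring
    rw [this, hsub, smul_pt, cross_pt]
    push_cast; ring
  have hz : i * (n - n') - j * (m - m') = 0 := by
    rw [hcr, abs_div, abs_mul, abs_of_pos (by positivity),
      ← mul_div_assoc ε (Real.sqrt 3 / 2) |inner ℝ (pt i j) ν|,
      div_lt_div_iff_of_pos_right (abs_pos.2 he)] at hclose
    have h1 : |((i * (n - n') - j * (m - m') : ℤ) : ℝ)| < 1 := by
      have hpos : 0 < ε * (Real.sqrt 3 / 2) := by positivity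
      exact (mul_lt_iff_lt_one_right hpos).1 hclose
    have h2 : |i * (n - n') - j * (m - m')| < 1 := by exact_mod_cast h1
    exact Int.abs_lt_one_iff.1 h2
  -- The number of steps along the row: `(i + j) * i + j * j = 1`, so this functional recovers `k`
  -- from `k * (i, j)`.
  set k := (i + j) * (m - m') + j * (n - n') with hk
  have hij' : i * i + i * j + j * j = 1 := hij
  have hmk : m - m' = k * i := by
    rw [hk]; linear_combination (-(m - m')) * hij' - j * hz
  have hnk : n - n' = k * j := by
    rw [hk]; linear_combination (-(n - n')) * hij' + (i + j) * hz
  have hsub' : a - a' = (k * ε) • pt i j := by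
    rw [hsub, hmk, hnk, mul_comm (k : ℝ), mul_smul, smul_pt (k : ℝ)]; push_cast; rfl
  set β := ε * inner ℝ (pt i j) ν with hβ
  have e1 : inner ℝ (b - x₀) ν = inner ℝ (a - x₀) ν + β := by
    rw [hβ, ← real_inner_smul_left, ← inner_add_left, ← hab]; congr 1; abel
  have e2 : inner ℝ (b' - x₀) ν = inner ℝ (a' - x₀) ν + β := by
    rw [hβ, ← real_inner_smul_left, ← inner_add_left, ← hab']; congr 1; abel
  have e3 : inner ℝ (a - x₀) ν = inner ℝ (a' - x₀) ν + k * β := by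
    rw [hβ, ← mul_assoc, ← real_inner_smul_left, ← inner_add_left, ← hsub']; congr 1; abel
  unfold Crosses at h h'
  rw [e1, e3] at h
  rw [e2] at h'
  have hk0 := eq_zero_of_cross_twice h' h
  rw [hk0, Int.cast_zero, zero_mul, zero_smul, sub_eq_zero] at hsub'
  refine ⟨hsub', ?_⟩
  have : b - a = b' - a' := by rw [hab, hab']
  rw [hsub'] at this
  exact sub_left_injective this

open Classical in
/-- The bonds of a given direction which cross a line are counted by the length of the line. -/
lemma tsum_crossing_le {Ω : Set Plane} (hν : ‖ν‖ = 1) {ε : ℝ} (hε : 0 < ε) {i j : ℤ}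
    (hij : HexUnit i j) :
    ∑' p : bonds Ω ε, (if p.1.2 - p.1.1 = ε • pt i j ∧ Crosses x₀ ν p.1.1 p.1.2 then
        ENNReal.ofReal ε else 0) ≤
      ENNReal.ofReal (2 / Real.sqrt 3 * |inner ℝ (pt i j) ν|) *
        volume (Metric.cthickening (ε * (Real.sqrt 3 / 2 / |inner ℝ (pt i j) ν|))
          {s | line x₀ ν s ∈ Ω}) := by
  have h3 := sqrt_three_pos
  by_cases he : inner ℝ (pt i j) ν = 0
  · have : ∀ p : bonds Ω ε, ¬ (p.1.2 - p.1.1 = ε • pt i j ∧ Crosses x₀ ν p.1.1 p.1.2) := by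
      rintro p ⟨h1, h2⟩
      have e1 : inner ℝ (p.1.2 - x₀) ν = inner ℝ (p.1.1 - x₀) ν := by
        rw [show p.1.2 - x₀ = (p.1.2 - p.1.1) + (p.1.1 - x₀) by abel, inner_add_left, h1,
          real_inner_smul_left, he, mul_zero, zero_add]
      unfold Crosses at h2
      rw [e1] at h2
      rcases h2 with ⟨h4, h5⟩ | ⟨h4, h5⟩ <;> linarith
    simp [this]
  · have hα : 0 < |inner ℝ (pt i j) ν| := abs_pos.2 he
    set d := ε * (Real.sqrt 3 / 2 / |inner ℝ (pt i j) ν|) with hd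
    -- Each crossing bond receives an interval whose length `d` is the minimal spacing of crossing
    -- points. The intervals are disjoint and stay in the `d`-thickening of the interface, and `ε`
    -- is `2 / √3 * |⟨e, ν⟩|` times `d`.
    let As : bonds Ω ε → Set ℝ := fun p =>
      if p.1.2 - p.1.1 = ε • pt i j ∧ Crosses x₀ ν p.1.1 p.1.2 then
        Set.Ico (crossParam x₀ ν (pt i j) p.1.1) (crossParam x₀ ν (pt i j) p.1.1 + d) else ∅
    have hterm : ∀ p : bonds Ω ε,
        (if p.1.2 - p.1.1 = ε • pt i j ∧ Crosses x₀ ν p.1.1 p.1.2 then ENNReal.ofReal ε else 0) =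
          ENNReal.ofReal (2 / Real.sqrt 3 * |inner ℝ (pt i j) ν|) * volume (As p) := by
      intro p
      simp only [As]
      split_ifs with hp
      · rw [Real.volume_Ico, ← ENNReal.ofReal_mul (by positivity), hd]
        congr 1
        field_simp
        ring
      · simp
    have hdisj : Pairwise (Function.onFun Disjoint As) := by
      intro p p' hne
      rw [Function.onFun, Set.disjoint_left]
      intro s hs hs'
      simp only [As] at hs hs'
      split_ifs at hs hs' with hp hp'
      · apply hne
        have := eq_of_crossParam_close hε hij he p.2.1 p'.2.1 hp.1 hp'.1 hp.2 hp'.2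
          (by rw [abs_lt]; constructor <;> linarith [hs.1, hs.2, hs'.1, hs'.2])
        exact Subtype.ext (Prod.ext this.1 this.2)
      all_goals simp_all
    rw [tsum_congr hterm, ENNReal.tsum_mul_left]
    gcongr
    refine (tsum_meas_le_meas_iUnion_of_disjoint volume (fun p => ?_) hdisj).trans
      (measure_mono (Set.iUnion_subset fun p => ?_))
    · simp only [As]; split_ifs
      · exact measurableSet_Ico
      · exact MeasurableSet.empty
    · simp only [As]; split_ifs with hp
      · intro s hs
        refine Metric.mem_cthickening_of_dist_le s _ d _ (crossParam_mem hν he hp.1 hp.2 p.2.2.2.1) ?_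
        rw [Real.dist_eq, abs_le]
        constructor <;> linarith [hs.1, hs.2]
      · exact Set.empty_subset _

/-- The three directions of the bonds. -/
lemma bond_direction {Ω : Set Plane} {ε : ℝ} (hε : 0 < ε) {p : Plane × Plane} (hp : p ∈ bonds Ω ε) :
    p.2 - p.1 = ε • pt (1 : ℤ) (0 : ℤ) ∨ p.2 - p.1 = ε • pt (0 : ℤ) (1 : ℤ) ∨
      p.2 - p.1 = ε • pt (1 : ℤ) (-1 : ℤ) := by
  obtain ⟨h1, h2, -, hd, hlex⟩ := hp
  obtain ⟨m, n, hm⟩ := mem_lattice_iff.1 h1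
  obtain ⟨m', n', hm'⟩ := mem_lattice_iff.1 h2
  have hsub : p.2 - p.1 = ε • pt ((m' - m : ℤ) : ℝ) ((n' - n : ℤ) : ℝ) := by
    rw [hm, hm', ← smul_sub, pt_sub]; push_cast; rfl
  have hu : HexUnit (m' - m) (n' - n) := hexUnit_of_dist hε (by rw [← hm, ← hm']; exact hd)
  have hpos : ∀ {i j : ℤ}, p.2 - p.1 = ε • pt i j → (0 : ℝ) ≤ (i : ℝ) + j / 2 := by
    intro i j h
    have e0 := congrArg (fun z : Plane => z 0) h
    simp only [PiLp.sub_apply, PiLp.smul_apply, pt_zero, smul_eq_mul] at e0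
    have : 0 ≤ p.2 0 - p.1 0 := by rcases hlex with h | ⟨h, -⟩ <;> linarith
    rw [e0] at this
    exact nonneg_of_mul_nonneg_right this hε
  rcases hu.cases with ⟨ha, hb⟩ | ⟨ha, hb⟩ | ⟨ha, hb⟩ | ⟨ha, hb⟩ | ⟨ha, hb⟩ | ⟨ha, hb⟩ <;>
    rw [ha, hb] at hsub
  · exact Or.inl hsub
  · have := hpos hsub; norm_num at this
  · exact Or.inr (Or.inl hsub)
  · have := hpos hsub; norm_num at this
  · exact Or.inr (Or.inr hsub)
  · have := hpos hsub; norm_num at this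

/-- The measure of the crossing points, weighted by the density of the bonds of direction `e`. -/
def crossBound (Ω : Set Plane) (x₀ ν e : Plane) (ε : ℝ) : ℝ≥0∞ :=
  ENNReal.ofReal (2 / Real.sqrt 3 * |inner ℝ e ν|) *
    volume (Metric.cthickening (ε * (Real.sqrt 3 / 2 / |inner ℝ e ν|)) {s | line x₀ ν s ∈ Ω})

open Classical in
lemma pairEnergy_le {J : ℝ≥0 → ℝ≥0∞} {Ω : Set Plane} (hν : ‖ν‖ = 1) {ε : ℝ} (hε : 0 < ε)
    {w : Plane → Plane} {M : ℝ≥0∞}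
    (h0 : ∀ p ∈ bonds Ω ε, ¬ Crosses x₀ ν p.1 p.2 → J ‖ε⁻¹ • (w p.1 - w p.2)‖₊ = 0)
    (h1 : ∀ p ∈ bonds Ω ε, Crosses x₀ ν p.1 p.2 → J ‖ε⁻¹ • (w p.1 - w p.2)‖₊ ≤ M) :
    pairEnergy J Ω ε w ≤ M * (crossBound Ω x₀ ν (pt 1 0) ε + crossBound Ω x₀ ν (pt 0 1) ε +
      crossBound Ω x₀ ν (pt 1 (-1)) ε) := by
  let f : ℤ → ℤ → bonds Ω ε → ℝ≥0∞ := fun i j p =>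
    if p.1.2 - p.1.1 = ε • pt i j ∧ Crosses x₀ ν p.1.1 p.1.2 then ENNReal.ofReal ε else 0
  have hle : ∀ p : bonds Ω ε, ENNReal.ofReal ε * J ‖ε⁻¹ • (w p.1.1 - w p.1.2)‖₊ ≤
      M * (f 1 0 p + f 0 1 p + f 1 (-1) p) := by
    intro p
    by_cases hc : Crosses x₀ ν p.1.1 p.1.2
    · have hε' : ENNReal.ofReal ε ≤ f 1 0 p + f 0 1 p + f 1 (-1) p := by
        rcases bond_direction hε p.2 with h | h | h
        · refine le_trans ?_ (le_add_right (le_add_right le_rfl))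
          simp only [f]; rw [if_pos ⟨h, hc⟩]
        · refine le_trans ?_ (le_add_right (le_add_left le_rfl))
          simp only [f]; rw [if_pos ⟨h, hc⟩]
        · refine le_trans ?_ (le_add_left le_rfl)
          simp only [f]; rw [if_pos ⟨h, hc⟩]
      rw [mul_comm]
      exact mul_le_mul' (h1 p.1 p.2 hc) hε'
    · rw [h0 p.1 p.2 hc, mul_zero]; exact zero_le
  have e1 := tsum_crossing_le (Ω := Ω) (x₀ := x₀) hν hε (i := 1) (j := 0) (by norm_num [HexUnit])
  have e2 := tsum_crossing_le (Ω := Ω) (x₀ := x₀) hν hε (i := 0) (j := 1) (by norm_num [HexUnit])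
  have e3 := tsum_crossing_le (Ω := Ω) (x₀ := x₀) hν hε (i := 1) (j := -1) (by norm_num [HexUnit])
  calc pairEnergy J Ω ε w ≤ ∑' p : bonds Ω ε, M * (f 1 0 p + f 0 1 p + f 1 (-1) p) :=
        ENNReal.tsum_le_tsum hle
    _ = M * (∑' p, f 1 0 p + ∑' p, f 0 1 p + ∑' p, f 1 (-1) p) := by
        rw [ENNReal.tsum_mul_left, ENNReal.tsum_add, ENNReal.tsum_add]
    _ ≤ _ := by
        gcongr
        · simpa [f, crossBound] using e1
        · simpa [f, crossBound] using e2
        · simpa [f, crossBound] using e3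

/-- The closed thickenings of a bounded set decrease to its closure, and their measures with them.
-/
lemma tendsto_crossBound {Ω : Set Plane} (hb : Bornology.IsBounded Ω) (hν : ‖ν‖ = 1) (e : Plane) :
    Tendsto (crossBound Ω x₀ ν e) (𝓝[>] 0)
      (𝓝 (ENNReal.ofReal (2 / Real.sqrt 3 * |inner ℝ e ν|) *
        volume (closure {s | line x₀ ν s ∈ Ω}))) := by
  have hU : Bornology.IsBounded {s | line x₀ ν s ∈ Ω} :=
    (isometry_line hν).antilipschitz.isBounded_preimage hb
  refine ENNReal.Tendsto.const_mul ?_ (Or.inr ENNReal.ofReal_ne_top)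
  have h1 := tendsto_measure_cthickening (μ := volume) (s := {s | line x₀ ν s ∈ Ω})
    ⟨1, one_pos, hU.cthickening.measure_lt_top.ne⟩
  refine h1.comp ?_
  have : Tendsto (fun ε : ℝ => ε * (Real.sqrt 3 / 2 / |inner ℝ e ν|)) (𝓝 0)
      (𝓝 (0 * (Real.sqrt 3 / 2 / |inner ℝ e ν|))) := tendsto_id.mul_const _
  rw [zero_mul] at this
  exact this.mono_left nhdsWithin_le_nhds

lemma crossDensity_le (V : ℝ≥0∞) :
    ENNReal.ofReal (2 / Real.sqrt 3 * |inner ℝ (pt 1 0) ν|) * V +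
      ENNReal.ofReal (2 / Real.sqrt 3 * |inner ℝ (pt 0 1) ν|) * V +
      ENNReal.ofReal (2 / Real.sqrt 3 * |inner ℝ (pt 1 (-1)) ν|) * V ≤
      ENNReal.ofReal (4 / Real.sqrt 3 * psiStar ν) * V := by
  have h3 := sqrt_three_pos
  rw [← add_mul, ← add_mul, ← ENNReal.ofReal_add (by positivity) (by positivity),
    ← ENNReal.ofReal_add (by positivity) (by positivity)]
  gcongr
  rw [← mul_add, ← mul_add]
  calc _ ≤ 2 / Real.sqrt 3 * (2 * psiStar ν) := by gcongr; exact sum_abs_inner_le ν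
    _ = _ := by ring

/-! ### The energy of the recovery sequence -/

section Recovery

variable {Ω : Set Plane} {Rp Rm : Matrix (Fin 2) (Fin 2) ℝ} {x₀ ν qp qm ν₁ ν₂ : Plane} {δ ε : ℝ}

lemma nnnorm_inv_smul_eq_one (hε : 0 < ε) {v : Plane} (h : ‖v‖ = ε) : ‖ε⁻¹ • v‖₊ = 1 := by
  rw [← NNReal.coe_inj, coe_nnnorm, norm_smul, h, norm_inv, Real.norm_of_nonneg hε.le,
    inv_mul_cancel₀ hε.ne', NNReal.coe_one]

lemma dist_eq_of_rigid {w : Plane → Plane} {a b q : Plane} {R : Matrix (Fin 2) (Fin 2) ℝ}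
    (hR : IsRot R) (ha : w a = act R a + q) (hb : w b = act R b + q) :
    ‖w a - w b‖ = dist a b := by
  rw [ha, hb, add_sub_add_right_eq_sub, ← act_sub, hR.norm_act, dist_eq_norm]

lemma eq_rigid_of_not_crosses (hRp : IsRot Rp) (hRm : IsRot Rm) {a b : Plane}
    (h : ¬ Crosses x₀ ν a b) : ∃ R q, IsRot R ∧
      twoPiece Rp Rm x₀ ν qp qm a = act R a + q ∧ twoPiece Rp Rm x₀ ν qp qm b = act R b + q := by
  unfold Crosses at h
  push Not at h
  rcases lt_or_ge 0 (inner ℝ (a - x₀) ν) with ha | ha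
  · exact ⟨Rp, qp, hRp, twoPiece_of_pos ha, twoPiece_of_pos (h.1 ha)⟩
  · exact ⟨Rm, qm, hRm, twoPiece_of_nonpos ha, twoPiece_of_nonpos (h.2 ha)⟩

lemma IsTriangleIn.rotate {a b c : Plane} (h : IsTriangleIn Ω ε a b c) :
    IsTriangleIn Ω ε b c a := by
  obtain ⟨ha, hb, hc, hab, hbc, hca, hsub⟩ := h
  refine ⟨hb, hc, ha, hbc, hca, hab, ?_⟩
  rwa [show ({b, c, a} : Set Plane) = {a, b, c} by ext; simp; tauto]

lemma IsTriangleIn.segment_subset {a b c : Plane} (h : IsTriangleIn Ω ε a b c) :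
    segment ℝ a b ⊆ Ω :=
  (segment_subset_convexHull (by simp) (by simp)).trans h.2.2.2.2.2.2

/-- The difference of the values on the two sides is close to the jump. -/
lemma exists_jump_close (hν : ‖ν‖ = 1) (hRp : IsRot Rp) (hRm : IsRot Rm) {a b : Plane}
    (ha : 0 < inner ℝ (a - x₀) ν) (hb : inner ℝ (b - x₀) ν ≤ 0) (hsub : segment ℝ a b ⊆ Ω) :
    ∃ s, line x₀ ν s ∈ Ω ∧ ‖twoPiece Rp Rm x₀ ν qp qm a - twoPiece Rp Rm x₀ ν qp qm b -
      jump Rp Rm qp qm (line x₀ ν s)‖ ≤ 2 * dist a b := by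
  obtain ⟨s, hs, h1, h2⟩ := Crosses.exists_line hν (Or.inl ⟨ha, hb⟩) hsub
  refine ⟨s, hs, ?_⟩
  rw [twoPiece_of_pos ha, twoPiece_of_nonpos hb]
  have e : act Rp a + qp - (act Rm b + qm) - jump Rp Rm qp qm (line x₀ ν s) =
      act Rp (a - line x₀ ν s) - act Rm (b - line x₀ ν s) := by
    rw [jump, act_sub, act_sub]; abel
  rw [e]
  refine (norm_sub_le _ _).trans ?_
  rw [hRp.norm_act, hRm.norm_act]
  linarith

lemma inner_pos_of_close {v V n : Plane} {R : Matrix (Fin 2) (Fin 2) ℝ} (hR : IsRot R)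
    (hn : ‖n‖ = 1) (h : δ ≤ inner ℝ v (act R n)) (hV : ‖V - v‖ < δ) : 0 < inner ℝ V (act R n) := by
  have h1 := abs_real_inner_le_norm (V - v) (act R n)
  rw [hR.norm_act, hn, mul_one, inner_sub_left] at h1
  have := (abs_le.1 h1).1
  linarith

lemma neg_mem_coordDirections {n : Plane} (h : n ∈ coordDirections) : -n ∈ coordDirections := by
  obtain ⟨s, hs, rfl⟩ := h
  exact ⟨-s, neg_mem_unitVectors hs, by apply plane_ext <;> simp⟩

variable {t r : ℝ}

/-- A vertex on the positive side, two on the other one. -/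
lemma oriented_of_pos_neg_neg (hν : ‖ν‖ = 1) (hRp : IsRot Rp) (hRm : IsRot Rm)
    (hν₁ : ν₁ ∈ coordDirections) (hν₂ : ν₂ ∈ coordDirections) (ht : t ∈ Set.Ioo (0 : ℝ) 1)
    (hr : 0 < r) (hdecomp : r • ν = t • ν₁ + (1 - t) • ν₂) (hε : 0 < ε) (hεδ : 2 * ε < δ)
    (hO : ∀ s, line x₀ ν s ∈ Ω → Opening Rp Rm ν₁ ν₂ δ (jump Rp Rm qp qm (line x₀ ν s)))
    {a b c : Plane} (hT : IsTriangleIn Ω ε a b c) (ha : 0 < inner ℝ (a - x₀) ν)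
    (hb : inner ℝ (b - x₀) ν ≤ 0) (hc : inner ℝ (c - x₀) ν ≤ 0) :
    Oriented (twoPiece Rp Rm x₀ ν qp qm) a b c := by
  obtain ⟨s, hs, hclose⟩ := exists_jump_close (Ω := Ω) (qp := qp) (qm := qm) hν hRp hRm ha hb
    hT.segment_subset
  rw [hT.2.2.2.1] at hclose
  have hlt := hclose.trans_lt hεδ
  have hop := hO s hs
  have hsep : ∀ z, inner ℝ (z - x₀) ν ≤ 0 → 0 < inner ℝ (a - z) ν := by
    intro z hz
    rw [show a - z = (a - x₀) - (z - x₀) by abel, inner_sub_left]; linarith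
  -- The edge `bc` is on the negative side and turns with `Rm`; the mirrored case uses `Rp`, so
  -- opening is needed for both rotations.
  refine oriented_of_separated hε hT hν₁ hν₂ ht hr hdecomp (hsep b hb) (hsep c hc) hRm ?_ ?_ ?_
  · rw [twoPiece_of_nonpos hb, twoPiece_of_nonpos hc, act_sub]; abel
  · exact inner_pos_of_close hRm (norm_of_mem_coordDirections hν₁) hop.2.1 hlt
  · exact inner_pos_of_close hRm (norm_of_mem_coordDirections hν₂) hop.2.2.2 hlt

/-- A vertex on the negative side, two on the other one. -/
lemma oriented_of_neg_pos_pos (hν : ‖ν‖ = 1) (hRp : IsRot Rp) (hRm : IsRot Rm)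
    (hν₁ : ν₁ ∈ coordDirections) (hν₂ : ν₂ ∈ coordDirections) (ht : t ∈ Set.Ioo (0 : ℝ) 1)
    (hr : 0 < r) (hdecomp : r • ν = t • ν₁ + (1 - t) • ν₂) (hε : 0 < ε) (hεδ : 2 * ε < δ)
    (hO : ∀ s, line x₀ ν s ∈ Ω → Opening Rp Rm ν₁ ν₂ δ (jump Rp Rm qp qm (line x₀ ν s)))
    {a b c : Plane} (hT : IsTriangleIn Ω ε a b c) (ha : inner ℝ (a - x₀) ν ≤ 0)
    (hb : 0 < inner ℝ (b - x₀) ν) (hc : 0 < inner ℝ (c - x₀) ν) :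
    Oriented (twoPiece Rp Rm x₀ ν qp qm) a b c := by
  obtain ⟨s, hs, hclose⟩ := exists_jump_close (Ω := Ω) (qp := qp) (qm := qm) hν hRp hRm hb ha
    (by rw [segment_symm]; exact hT.segment_subset)
  rw [dist_comm, hT.2.2.2.1] at hclose
  have hlt := hclose.trans_lt hεδ
  have hop := hO s hs
  have hsep : ∀ z, 0 < inner ℝ (z - x₀) ν → 0 < inner ℝ (a - z) (-ν) := by
    intro z hz
    rw [show a - z = (a - x₀) - (z - x₀) by abel, inner_neg_right, inner_sub_left]; linarith
  have hneg : ∀ v n : Plane, inner ℝ v (act Rp (-n)) = inner ℝ (-v) (act Rp n) := by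
    intro v n
    rw [show act Rp (-n) = -act Rp n from map_neg _ _, inner_neg_right, inner_neg_left]
  -- With the sides exchanged, `ν`, `ν₁`, `ν₂` and the displacement all change sign, so the products
  -- keep theirs.
  refine oriented_of_separated hε hT (neg_mem_coordDirections hν₁) (neg_mem_coordDirections hν₂)
    ht hr (by rw [smul_neg, hdecomp]; module) (hsep b hb) (hsep c hc) hRp ?_ ?_ ?_
  · rw [twoPiece_of_pos hb, twoPiece_of_pos hc, act_sub]; abel
  · rw [hneg, neg_sub]
    exact inner_pos_of_close hRp (norm_of_mem_coordDirections hν₁) hop.1 hlt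
  · rw [hneg, neg_sub]
    exact inner_pos_of_close hRp (norm_of_mem_coordDirections hν₂) hop.2.2.1 hlt

lemma admissible_of_opening (hν : ‖ν‖ = 1) (hRp : IsRot Rp) (hRm : IsRot Rm)
    (hν₁ : ν₁ ∈ coordDirections) (hν₂ : ν₂ ∈ coordDirections) (ht : t ∈ Set.Ioo (0 : ℝ) 1)
    (hr : 0 < r) (hdecomp : r • ν = t • ν₁ + (1 - t) • ν₂) (hε : 0 < ε) (hεδ : 2 * ε < δ)
    (hO : ∀ s, line x₀ ν s ∈ Ω → Opening Rp Rm ν₁ ν₂ δ (jump Rp Rm qp qm (line x₀ ν s))) :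
    Admissible Ω ε (twoPiece Rp Rm x₀ ν qp qm) := by
  intro a b c hT
  apply Oriented.exists_affineMap
  have P := fun {a b c : Plane} => oriented_of_pos_neg_neg (qp := qp) (qm := qm) (a := a) (b := b)
    (c := c) hν hRp hRm hν₁ hν₂ ht hr hdecomp hε hεδ hO
  have N := fun {a b c : Plane} => oriented_of_neg_pos_pos (qp := qp) (qm := qm) (a := a) (b := b)
    (c := c) hν hRp hRm hν₁ hν₂ ht hr hdecomp hε hεδ hO
  have hcr := hT.cross_ne_zero hε
  rcases lt_or_ge 0 (inner ℝ (a - x₀) ν) with ha | ha <;>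
  rcases lt_or_ge 0 (inner ℝ (b - x₀) ν) with hb | hb <;>
  rcases lt_or_ge 0 (inner ℝ (c - x₀) ν) with hc | hc
  · exact oriented_of_rigid hRp hcr (twoPiece_of_pos ha) (twoPiece_of_pos hb) (twoPiece_of_pos hc)
  · exact (N hT.rotate.rotate hc ha hb).rotate.rotate
  · exact (N hT.rotate hb hc ha).rotate
  · exact P hT ha hb hc
  · exact N hT ha hb hc
  · exact (P hT.rotate hb hc ha).rotate
  · exact (P hT.rotate.rotate hc ha hb).rotate.rotate
  · exact oriented_of_rigid hRm hcr (twoPiece_of_nonpos ha) (twoPiece_of_nonpos hb)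
      (twoPiece_of_nonpos hc)

/-- The jump has norm at least `δ`, since its product with a unit vector is; moving from the
crossing point to the ends of the bond costs at most `2 * dist a b`. -/
lemma norm_sub_ge_of_crosses (hν : ‖ν‖ = 1) (hRp : IsRot Rp) (hRm : IsRot Rm)
    (hν₁ : ν₁ ∈ coordDirections)
    (hO : ∀ s, line x₀ ν s ∈ Ω → Opening Rp Rm ν₁ ν₂ δ (jump Rp Rm qp qm (line x₀ ν s)))
    {a b : Plane} (h : Crosses x₀ ν a b) (hsub : segment ℝ a b ⊆ Ω) :
    δ - 2 * dist a b ≤ ‖twoPiece Rp Rm x₀ ν qp qm a - twoPiece Rp Rm x₀ ν qp qm b‖ := by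
  have key : ∀ {a b : Plane}, 0 < inner ℝ (a - x₀) ν → inner ℝ (b - x₀) ν ≤ 0 →
      segment ℝ a b ⊆ Ω →
      δ - 2 * dist a b ≤ ‖twoPiece Rp Rm x₀ ν qp qm a - twoPiece Rp Rm x₀ ν qp qm b‖ := by
    intro a b ha hb hsub
    obtain ⟨s, hs, hclose⟩ := exists_jump_close (qp := qp) (qm := qm) hν hRp hRm ha hb hsub
    have h1 := (hO s hs).1.trans (real_inner_le_norm _ _)
    rw [hRp.norm_act, norm_of_mem_coordDirections hν₁, mul_one] at h1
    have h2 := norm_sub_norm_le (jump Rp Rm qp qm (line x₀ ν s))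
      (twoPiece Rp Rm x₀ ν qp qm a - twoPiece Rp Rm x₀ ν qp qm b)
    rw [norm_sub_rev (jump Rp Rm qp qm (line x₀ ν s))] at h2
    linarith
  rcases h with ⟨ha, hb⟩ | ⟨ha, hb⟩
  · exact key ha hb hsub
  · rw [dist_comm, norm_sub_rev]
    exact key hb ha (by rwa [segment_symm])

lemma energy_recovery_le {J : ℝ≥0 → ℝ≥0∞} (hε : 0 < ε) (hε1 : ε ≤ 1) {w : Plane → Plane}
    (h : Admissible Ω ε w) : energy J Ω ε (recovery w ε) ≤ pairEnergy J Ω ε w := by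
  rw [recovery, if_pos hε1]
  exact iInf₂_le w ⟨h, isInterpolation_interp hε Ω w⟩

/-- The energy of the recovery sequence of an opening crack. -/
lemma limsup_energy_le_of_opening {J : ℝ≥0 → ℝ≥0∞} {Jinf : ℝ} (hJ : IsPotential J Jinf)
    (hb : Bornology.IsBounded Ω) (hν : ‖ν‖ = 1) (hRp : IsRot Rp) (hRm : IsRot Rm)
    (hν₁ : ν₁ ∈ coordDirections) (hν₂ : ν₂ ∈ coordDirections) (ht : t ∈ Set.Ioo (0 : ℝ) 1)
    (hr : 0 < r) (hdecomp : r • ν = t • ν₁ + (1 - t) • ν₂) (hδ : 0 < δ)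
    (hO : ∀ s, line x₀ ν s ∈ Ω → Opening Rp Rm ν₁ ν₂ δ (jump Rp Rm qp qm (line x₀ ν s))) :
    limsup (fun ε : ℝ => energy J Ω ε (recovery (twoPiece Rp Rm x₀ ν qp qm) ε)) (𝓝[>] 0) ≤
      ENNReal.ofReal (phi Jinf ν) * volume (closure {s | line x₀ ν s ∈ Ω}) := by
  set V := volume (closure {s | line x₀ ν s ∈ Ω}) with hV
  have hVfin : V ≠ ∞ :=
    ((isometry_line hν).antilipschitz.isBounded_preimage hb).closure.measure_lt_top.ne
  set D := ENNReal.ofReal (4 / Real.sqrt 3 * psiStar ν) * V with hD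
  have hDfin : D ≠ ∞ := ENNReal.mul_ne_top ENNReal.ofReal_ne_top hVfin
  -- The potential may approach its limit from above, so crossing bonds are estimated with `M >
  -- Jinf`, and `M` decreases to `Jinf` at the end.
  have main : ∀ M : ℝ≥0∞, ENNReal.ofReal Jinf < M → M ≠ ∞ →
      limsup (fun ε : ℝ => energy J Ω ε (recovery (twoPiece Rp Rm x₀ ν qp qm) ε)) (𝓝[>] 0) ≤
        M * D := by
    intro M hM hMfin
    obtain ⟨Z, hZ⟩ := eventually_atTop.1 (hJ.tendsto_atTop.eventually (gt_mem_nhds hM))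
    -- Crossing bonds have stretched length at least `δ - 2ε > Zε`, hence ratio above the threshold
    -- `Z` beyond which `J < M`; the same inequality gives `2ε < δ` for admissibility.
    have hsmall : ∀ᶠ ε in 𝓝[>] (0 : ℝ), 0 < ε ∧ ε ≤ 1 ∧ (Z + 2) * ε < δ := by
      have hZ2 : (0 : ℝ) < Z + 2 := by positivity
      filter_upwards [self_mem_nhdsWithin, mem_nhdsWithin_of_mem_nhds (Iio_mem_nhds one_pos),
        mem_nhdsWithin_of_mem_nhds (Iio_mem_nhds (div_pos hδ hZ2))] with ε h1 h2 h3
      refine ⟨h1, le_of_lt h2, ?_⟩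
      rw [mul_comm]
      exact (lt_div_iff₀ hZ2).1 h3
    have hev : ∀ᶠ ε in 𝓝[>] (0 : ℝ), energy J Ω ε (recovery (twoPiece Rp Rm x₀ ν qp qm) ε) ≤
        M * (crossBound Ω x₀ ν (pt 1 0) ε + crossBound Ω x₀ ν (pt 0 1) ε +
          crossBound Ω x₀ ν (pt 1 (-1)) ε) := by
      filter_upwards [hsmall] with ε ⟨hε, hε1, hεδ⟩
      have hZε : 0 ≤ Z * ε := by positivity
      refine (energy_recovery_le hε hε1 (admissible_of_opening hν hRp hRm hν₁ hν₂ ht hr hdecomp hε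
        (by linarith) hO)).trans (pairEnergy_le hν hε ?_ ?_)
      · intro p hp hc
        obtain ⟨R, q, hR, h1, h2⟩ := eq_rigid_of_not_crosses (qp := qp) (qm := qm) hRp hRm hc
        rw [nnnorm_inv_smul_eq_one hε ((dist_eq_of_rigid hR h1 h2).trans hp.2.2.2.1), hJ.min_eq]
      · intro p hp hc
        refine (hZ _ ?_).le
        have h1 := norm_sub_ge_of_crosses hν hRp hRm hν₁ hO hc hp.2.2.1
        rw [hp.2.2.2.1] at h1
        change (Z : ℝ) ≤ ‖ε⁻¹ • (twoPiece Rp Rm x₀ ν qp qm p.1 - twoPiece Rp Rm x₀ ν qp qm p.2)‖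
        rw [norm_smul, norm_inv, Real.norm_of_nonneg hε.le, ← div_eq_inv_mul, le_div_iff₀ hε]
        linarith
    refine (limsup_le_limsup hev).trans ?_
    have hlim := ENNReal.Tendsto.const_mul (a := M)
      (((tendsto_crossBound (x₀ := x₀) hb hν (pt 1 0)).add
      (tendsto_crossBound (x₀ := x₀) hb hν (pt 0 1))).add
      (tendsto_crossBound (x₀ := x₀) hb hν (pt 1 (-1)))) (Or.inr hMfin)
    rw [hlim.limsup_eq]
    gcongr
    exact crossDensity_le V
  have hphi : ENNReal.ofReal (phi Jinf ν) * V = ENNReal.ofReal Jinf * D := by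
    rw [hD, phi, ← mul_assoc, ← ENNReal.ofReal_mul hJ.limit_pos.le, mul_assoc Jinf]
  rw [hphi]
  have hseq : Tendsto (fun x : ℝ => ENNReal.ofReal x * D) (𝓝[>] Jinf)
      (𝓝 (ENNReal.ofReal Jinf * D)) :=
    ENNReal.Tendsto.mul_const
      ((ENNReal.continuous_ofReal.tendsto Jinf).mono_left nhdsWithin_le_nhds) (Or.inr hDfin)
  refine ge_of_tendsto hseq ?_
  filter_upwards [self_mem_nhdsWithin] with x hx
  exact main _ ((ENNReal.ofReal_lt_ofReal_iff (hJ.limit_pos.trans hx)).2 hx) ENNReal.ofReal_ne_top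

/-! ### The case of a vanishing jump -/

/-- If the jump vanishes along the interface then the deformation is rigid on convex sets. -/
lemma exists_rigid_of_jump_eq_zero (hΩ : IsOpen Ω) (hν : ‖ν‖ = 1) (hRp : IsRot Rp)
    (hRm : IsRot Rm)
    (h0 : ∀ s, line x₀ ν s ∈ Ω → jump Rp Rm qp qm (line x₀ ν s) = 0) {C : Set Plane}
    (hC : Convex ℝ C) (hCΩ : C ⊆ Ω) :
    ∃ R q, IsRot R ∧ ∀ x ∈ C, twoPiece Rp Rm x₀ ν qp qm x = act R x + q := by
  by_cases hpos : ∃ a ∈ C, 0 < inner ℝ (a - x₀) ν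
  · by_cases hneg : ∃ b ∈ C, inner ℝ (b - x₀) ν ≤ 0
    · obtain ⟨a, ha, ha'⟩ := hpos
      obtain ⟨b, hb, hb'⟩ := hneg
      obtain ⟨s, hs, -, -⟩ := Crosses.exists_line hν (Or.inl ⟨ha', hb'⟩)
        ((hC.segment_subset ha hb).trans hCΩ)
      -- Openness supplies a second zero of the jump on the line. Two zeros give `Rp (perp ν) = Rm
      -- (perp ν)`, so the rotations agree, and then so do the translations.
      have hopen : IsOpen {s | line x₀ ν s ∈ Ω} := hΩ.preimage (isometry_line hν).continuous
      obtain ⟨ρ, hρ, hball⟩ := Metric.isOpen_iff.1 hopen s hs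
      have hs' : line x₀ ν (s + ρ / 2) ∈ Ω := hball (by
        rw [Metric.mem_ball, Real.dist_eq, add_sub_cancel_left, abs_of_pos (half_pos hρ)]
        linarith)
      have h1 := jump_line_eq (Rp := Rp) (Rm := Rm) (qp := qp) (qm := qm) (x₀ := x₀) (ν := ν)
        (s + ρ / 2) s
      rw [h0 _ hs', h0 _ hs, zero_add, eq_comm, smul_eq_zero, add_sub_cancel_left] at h1
      have h2 := sub_eq_zero.1 (h1.resolve_left (half_pos hρ).ne')
      have hne : perp ν ≠ 0 := by rw [← norm_ne_zero_iff, norm_perp, hν]; exact one_ne_zero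
      have hR : Rp = Rm := hRp.eq_of_act_eq hRm hne h2
      have hq : qp = qm := by
        have := h0 _ hs
        rw [jump, hR, add_sub_add_left_eq_sub] at this
        exact sub_eq_zero.1 this
      refine ⟨Rp, qp, hRp, fun x _ => ?_⟩
      rcases lt_or_ge 0 (inner ℝ (x - x₀) ν) with h | h
      · exact twoPiece_of_pos h
      · rw [twoPiece_of_nonpos h, hR, hq]
    · push Not at hneg
      exact ⟨Rp, qp, hRp, fun x hx => twoPiece_of_pos (hneg x hx)⟩
  · push Not at hpos
    exact ⟨Rm, qm, hRm, fun x hx => twoPiece_of_nonpos (hpos x hx)⟩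

/-- The line may miss `Ω`, so the two rigid motions can differ; but each triangle or bond in `Ω` is
convex and sees only one of them. -/
lemma energy_recovery_eq_zero {J : ℝ≥0 → ℝ≥0∞} {Jinf : ℝ} (hJ : IsPotential J Jinf)
    (hΩ : IsOpen Ω) (hν : ‖ν‖ = 1) (hRp : IsRot Rp) (hRm : IsRot Rm)
    (h0 : ∀ s, line x₀ ν s ∈ Ω → jump Rp Rm qp qm (line x₀ ν s) = 0) (hε : 0 < ε) (hε1 : ε ≤ 1) :
    energy J Ω ε (recovery (twoPiece Rp Rm x₀ ν qp qm) ε) = 0 := by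
  have hadm : Admissible Ω ε (twoPiece Rp Rm x₀ ν qp qm) := by
    intro a b c hT
    obtain ⟨R, q, hR, h⟩ := exists_rigid_of_jump_eq_zero hΩ hν hRp hRm h0
      (convex_convexHull ℝ {a, b, c}) hT.2.2.2.2.2.2
    have hs := subset_convexHull ℝ ({a, b, c} : Set Plane)
    exact (oriented_of_rigid hR (hT.cross_ne_zero hε) (h a (hs (by simp))) (h b (hs (by simp)))
      (h c (hs (by simp)))).exists_affineMap
  refine le_antisymm ((energy_recovery_le hε hε1 hadm).trans (le_of_eq ?_)) zero_le
  rw [pairEnergy, ENNReal.tsum_eq_zero]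
  rintro ⟨p, hp⟩
  obtain ⟨R, q, hR, h⟩ := exists_rigid_of_jump_eq_zero hΩ hν hRp hRm h0
    (convex_segment p.1 p.2) hp.2.2.1
  rw [nnnorm_inv_smul_eq_one hε ((dist_eq_of_rigid hR (h _ (left_mem_segment ℝ _ _))
    (h _ (right_mem_segment ℝ _ _))).trans hp.2.2.2.1), hJ.min_eq, mul_zero]

end Recovery

end LatticeFracture

end

theorem mainTheorem4
    (Ω : Set Plane) (hΩ_open : IsOpen Ω) (hΩ_bdd : Bornology.IsBounded Ω)
    (J : ℝ≥0 → ℝ≥0∞) (Jinf : ℝ) (hJ : IsPotential J Jinf)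
    (Rp Rm : Matrix (Fin 2) (Fin 2) ℝ)
    (hRp : Rp ∈ Matrix.specialOrthogonalGroup (Fin 2) ℝ)
    (hRm : Rm ∈ Matrix.specialOrthogonalGroup (Fin 2) ℝ)
    (x₀ ν qp qm : Plane) (hν : ‖ν‖ = 1)
    (u : Plane → Plane) (hu : ∀ x ∈ Ω, u x = twoPiece Rp Rm x₀ ν qp qm x)
    (hS : μH[1] (closure (jumpSet Ω u) ∩ frontier Ω) = 0)
    (ν₁ ν₂ : Plane) (hν₁ : ν₁ ∈ coordDirections) (hν₂ : ν₂ ∈ coordDirections)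
    (t : ℝ) (ht : t ∈ Set.Ioo (0 : ℝ) 1) (c : ℝ) (hc : 0 < c)
    (hdecomp : c • ν = t • ν₁ + (1 - t) • ν₂)
    (δ : ℝ) (hδ : 0 < δ)
    (hopen : ∀ᵐ x ∂(μH[1] : Measure Plane), x ∈ jumpSet Ω u →
      ∀ a b : Plane, IsTrace u x ν a → IsTrace u x (-ν) b →
        δ ≤ inner ℝ (a - b) (act Rp ν₁) ∧ δ ≤ inner ℝ (a - b) (act Rm ν₁) ∧
        δ ≤ inner ℝ (a - b) (act Rp ν₂) ∧ δ ≤ inner ℝ (a - b) (act Rm ν₂)) :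
    gammaLimsup Ω (energy J Ω) u ≤
      ∫⁻ _x in jumpSet Ω u, ENNReal.ofReal (phi Jinf ν) ∂μH[1] := by
  have hRp' := isRot_of_mem hRp
  have hRm' := isRot_of_mem hRm
  have hν0 : ν ≠ 0 := by rw [← norm_ne_zero_iff, hν]; exact one_ne_zero
  refine (iInf₂_le (f := fun (v : ℝ → Plane → Plane) (_ : ConvergesTo Ω v u) =>
    limsup (fun ε : ℝ => energy J Ω ε (v ε)) (𝓝[>] 0)) _
    (convergesTo_recovery hΩ_open hΩ_bdd hRp' hRm' hν0 hu)).trans ?_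
  rcases jump_dichotomy hΩ_open hRp' hRm' hν hu hopen with h0 | hO
  · have hev : (fun ε : ℝ => energy J Ω ε (recovery (twoPiece Rp Rm x₀ ν qp qm) ε)) =ᶠ[𝓝[>] 0]
        fun _ => 0 := by
      filter_upwards [self_mem_nhdsWithin, mem_nhdsWithin_of_mem_nhds (Iio_mem_nhds one_pos)]
        with ε h1 h2
      exact energy_recovery_eq_zero hJ hΩ_open hν hRp' hRm' h0 h1 (le_of_lt h2)
    rw [limsup_congr hev, limsup_const]
    exact zero_le
  · refine (limsup_energy_le_of_opening hJ hΩ_bdd hν hRp' hRm' hν₁ hν₂ ht hc hdecomp hδ hO).trans ?_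
    rw [lintegral_const, Measure.restrict_apply_univ]
    gcongr
    -- The opening condition keeps the jump nonzero, so every point of the line in `Ω` belongs to
    -- the jump set.
    refine volume_closure_line_preimage_le hΩ_open hν (fun x hx => hx.1) hS fun s hs => ?_
    exact mem_jumpSet_of_jump_ne_zero hΩ_open hRp' hRm' hν hu hs (inner_line_sub s)
      ((hO s hs).ne_zero hδ)
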